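/- **Definitions.** A *biquandle* is a set $X$ with two binary operations $\underline{\triangleright},\overline{\triangleright}$ such that for all $x,y,z\in X$: (i) $x\,\underline{\triangleright}\,x=x\,\overline{\triangleright}\,x$; (ii) the maps $x\mapsto x\,\overline{\triangleright}\,y$, $x\mapsto x\,\underline{\triangleright}\,y$ and $(x,y)\mapsto(y\,\overline{\triangleright}\,x,\;x\,\underline{\triangleright}\,y)$ are bijective; (iii) $(x\,\underline{\triangleright}\,y)\,\underline{\triangleright}\,(z\,\underline{\triangleright}\,y)=(x\,\underline{\triangleright}\,z)\,\underline{\triangleright}\,(y\,\overline{\triangleright}\,z)$, $(x\,\underline{\triangleright}\,y)\,\overline{\triangleright}\,(z\,\underline{\triangleright}\,y)=(x\,\overline{\triangleright}\,z)\,\underline{\triangleright}\,(y\,\overline{\triangleright}\,z)$ and $(x\,\overline{\triangleright}\,y)\,\overline{\triangleright}\,(z\,\overline{\triangleright}\,y)=(x\,\overline{\triangleright}\,z)\,\overline{\triangleright}\,(y\,\underline{\triangleright}\,z)$. Endomorphisms of $X$ are the maps $X\to X$ preserving both operations. Let $R$ be a commutative ring with identity. A *biquandle bracket* $\beta$ over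 $R$ consists of maps $A,B:X\times X\to R^\times$ such that $-A_{x,x}^2B_{x,x}^{-1}$ has a common value $w\in R^\times$ for all $x\in X$, $-A_{x,y}^{-1}B_{x,y}-A_{x,y}B_{x,y}^{-1}$ has a common value $\delta\in R$ for all $x,y\in X$, and for all $x,y,z\in X$, writing $P=(x,y)$, $Q=(y,z)$, $T=(x\,\underline{\triangleright}\,y,\,z\,\overline{\triangleright}\,y)$, $U=(x,z)$, $V=(y\,\overline{\triangleright}\,x,\,z\,\overline{\triangleright}\,x)$, $W=(x\,\underline{\triangleright}\,z,\,y\,\underline{\triangleright}\,z)$, $$A_PA_QA_T=A_UA_VA_W,\qquad A_PB_QB_T=B_UB_VA_W,\qquad B_PA_QB_T=B_UA_VB_W,$$ $$A_PA_QB_T=A_UB_VA_W+A_UA_VB_W+\delta A_UB_VB_W+B_UB_VB_W,$$ $$B_PA_QA_T+A_PB_QA_T+\delta B_PB_QA_T+B_PB_QB_T=B_UA_VA_W.$$ An oriented link is an equivalence class of oriented link diagrams under planar isotopy and the oriented Reidemeister moves; knots are the links with one component. An $X$-*coloring* of a diagram $L$ assigns elements of $X$ to the semiarcs of $L$ such that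 at every crossing, drawn with both strands pointing down the page, if $x$ is the label on the left-hand semiarc of the under strand and $y$ the label on the left-hand semiarc of the over strand, then their right-hand semiarcs are labelled $x\,\underline{\triangleright}\,y$ and $y\,\overline{\triangleright}\,x$ respectively. The *bracket value* $\beta(f)$ of a coloring $f$ is the state sum obtained by smoothing every crossing in both ways: a positive crossing with left-hand labels $x,y$ as above contributes $A_{x,y}$ for the oriented and $B_{x,y}$ for the non-oriented smoothing, a negative one contributes $A_{x,y}^{-1}$ and $B_{x,y}^{-1}$; a state with $k$ closed curves gets the additional factor $\delta^k$; and the sum over all states is multiplied by $w^{n-p}$, where $p$ and $n$ are the numbers of positive and negative crossings of $L$. For a set $S$ of endomorphisms of $X$, the *biquandle bracket quiver* $\mathcal{BBQ}_{X,\beta}^S(L)$ is the directed graph whose vertices are the $X$-colorings $f$ of $L$, with one edge from $f$ to $\varphi f$ for every $\varphi\in S$, in which each vertex $f$ is weighted by $\beta(f)\in R$. **Theorem.** Let $X$ be a finite biquandle, $R$ a commutative ring with identity, $\beta$ a biquandle bracket on $X$ over $R$, and $S$ a set of biquandle endomorphisms of $X$. Then the isomorphism class of $\mathcal{BBQ}_{X,\beta}^S(L)$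 as a vertex-weighted directed graph is an invariant of oriented knots and links: if two diagrams $L$ and $L'$ represent the same oriented link, then there are a bijection between the vertices of $\mathcal{BBQ}_{X,\beta}^S(L)$ and $\mathcal{BBQ}_{X,\beta}^S(L')$ that preserves the weights and, for each ordered pair of vertices, a bijection between the edges from the first to the second and the edges between the corresponding vertices. -/

import Mathlib

/-! ### Biquandles and biquandle brackets -/

/-- A biquandle. `underBy x y` is `x` passing under `y` (lower triangle operation), and `overBy x y`
is `x` passing over `y` (upper triangle operation). -/
class Biquandle (X : Type*) where
  underBy : X → X → X
  overBy : X → X → X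
  under_self : ∀ x, underBy x x = overBy x x
  bijective_over : ∀ y, Function.Bijective fun x => overBy x y
  bijective_under : ∀ y, Function.Bijective fun x => underBy x y
  bijective_sideways : Function.Bijective fun p : X × X => (overBy p.2 p.1, underBy p.1 p.2)
  exchange_under_under : ∀ x y z,
    underBy (underBy x y) (underBy z y) = underBy (underBy x z) (overBy y z)
  exchange_under_over : ∀ x y z,
    overBy (underBy x y) (underBy z y) = underBy (overBy x z) (overBy y z)
  exchange_over_over : ∀ x y z,
    overBy (overBy x y) (overBy z y) = overBy (overBy x z) (underBy y z)

/-- A biquandle homomorphism. -/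
structure BiquandleHom (X Y : Type*) [Biquandle X] [Biquandle Y] where
  toFun : X → Y
  map_over : ∀ a b, toFun (Biquandle.overBy a b) = Biquandle.overBy (toFun a) (toFun b)
  map_under : ∀ a b, toFun (Biquandle.underBy a b) = Biquandle.underBy (toFun a) (toFun b)

/-- A biquandle bracket over `R`: unit-valued skein coefficients `A`, `B`, with the common
values `w` (of a positive kink) and `δ` (of a simple closed curve). -/
structure BiquandleBracket (X : Type*) [Biquandle X] (R : Type*) [CommRing R] where
  A : X → X → Rˣ
  B : X → X → Rˣ
  w : Rˣ
  δ : R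
  kink : ∀ x, -(A x x ^ 2 * (B x x)⁻¹) = w
  circle : ∀ x y,
    -(((A x y)⁻¹ : Rˣ) : R) * (B x y : R) - (A x y : R) * (((B x y)⁻¹ : Rˣ) : R) = δ
  AAA : ∀ x y z,
    (A x y * A y z * A (Biquandle.underBy x y) (Biquandle.overBy z y) : R) =
      A x z * A (Biquandle.overBy y x) (Biquandle.overBy z x)
        * A (Biquandle.underBy x z) (Biquandle.underBy y z)
  ABB : ∀ x y z,
    (A x y * B y z * B (Biquandle.underBy x y) (Biquandle.overBy z y) : R) =
      B x z * B (Biquandle.overBy y x) (Biquandle.overBy z x)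
        * A (Biquandle.underBy x z) (Biquandle.underBy y z)
  BAB : ∀ x y z,
    (B x y * A y z * B (Biquandle.underBy x y) (Biquandle.overBy z y) : R) =
      B x z * A (Biquandle.overBy y x) (Biquandle.overBy z x)
        * B (Biquandle.underBy x z) (Biquandle.underBy y z)
  AAB : ∀ x y z,
    (A x y * A y z * B (Biquandle.underBy x y) (Biquandle.overBy z y) : R) =
      A x z * B (Biquandle.overBy y x) (Biquandle.overBy z x)
          * A (Biquandle.underBy x z) (Biquandle.underBy y z)
        + A x z * A (Biquandle.overBy y x) (Biquandle.overBy z x)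
          * B (Biquandle.underBy x z) (Biquandle.underBy y z)
        + δ * A x z * B (Biquandle.overBy y x) (Biquandle.overBy z x)
          * B (Biquandle.underBy x z) (Biquandle.underBy y z)
        + B x z * B (Biquandle.overBy y x) (Biquandle.overBy z x)
          * B (Biquandle.underBy x z) (Biquandle.underBy y z)
  BAA : ∀ x y z,
    (B x y * A y z * A (Biquandle.underBy x y) (Biquandle.overBy z y)
        + A x y * B y z * A (Biquandle.underBy x y) (Biquandle.overBy z y)
        + δ * B x y * B y z * A (Biquandle.underBy x y) (Biquandle.overBy z y)
        + B x y * B y z * B (Biquandle.underBy x y) (Biquandle.overBy z y) : R) =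
      B x z * A (Biquandle.overBy y x) (Biquandle.overBy z x)
        * A (Biquandle.underBy x z) (Biquandle.underBy y z)

/-! ### Oriented link diagrams -/

/-- The two strands passing through a crossing. -/
inductive Strand
  /-- The strand on top. -/
  | upper
  /-- The strand below. -/
  | lower

/-- The other strand of a crossing. -/
def Strand.other : Strand → Strand
  | .upper => .lower
  | .lower => .upper

/-- An oriented link diagram, recorded combinatorially (a signed, oriented planar diagram code;
planarity is the separate predicate `Diagram.IsPlanar`). `Arc` is the set of semiarcs. The strand
`s` through the crossing `c` enters `c` along the semiarc `inn c s` and leaves it along `out c s`.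
Every semiarc ends at most once and begins at most once at a crossing; a semiarc that does
neither is a simple closed curve without crossings. The sign of a crossing is `1` (positive) if the
over strand crosses from left to right as seen along the under strand, and `-1` (negative) otherwise. -/
structure Diagram where
  Crossing : Type
  Arc : Type
  [fintypeCrossing : Fintype Crossing]
  [decEqCrossing : DecidableEq Crossing]
  [finiteArc : Finite Arc]
  sign : Crossing → ℤˣ
  inn : Crossing → Strand → Arc
  out : Crossing → Strand → Arc
  inn_injective : Function.Injective fun p : Crossing × Strand => inn p.1 p.2
  out_injective : Function.Injective fun p : Crossing × Strand => out p.1 p.2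
  range_inn_eq_range_out :
    (Set.range fun p : Crossing × Strand => inn p.1 p.2) =
      Set.range fun p : Crossing × Strand => out p.1 p.2

namespace Diagram

attribute [instance] fintypeCrossing decEqCrossing finiteArc

/-! Draw a crossing with both strands pointing down the page. If it is positive, then the under
strand runs from top left to bottom right and the over strand from top right to bottom left; if it
is negative, then it is the other way round. -/

/-- The strand that runs from top left to bottom right. -/
def leftStrand (D : Diagram) (c : D.Crossing) : Strand :=
  if D.sign c = 1 then .lower else .upper

/-- The semiarc at the top left of a crossing. -/
def topLeft (D : Diagram) (c : D.Crossing) : D.Arc := D.inn c (D.leftStrand c)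

/-- The semiarc at the bottom right of a crossing. -/
def bottomRight (D : Diagram) (c : D.Crossing) : D.Arc := D.out c (D.leftStrand c)

/-- The semiarc at the top right of a crossing. -/
def topRight (D : Diagram) (c : D.Crossing) : D.Arc := D.inn c (D.leftStrand c).other

/-- The semiarc at the bottom left of a crossing. -/
def bottomLeft (D : Diagram) (c : D.Crossing) : D.Arc := D.out c (D.leftStrand c).other

/-- The left one of the two semiarcs of the under strand. -/
def underLeft (D : Diagram) (c : D.Crossing) : D.Arc :=
  if D.sign c = 1 then D.inn c .lower else D.out c .lower

/-- The right one of the two semiarcs of the under strand. -/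
def underRight (D : Diagram) (c : D.Crossing) : D.Arc :=
  if D.sign c = 1 then D.out c .lower else D.inn c .lower

/-- The left one of the two semiarcs of the over strand. -/
def overLeft (D : Diagram) (c : D.Crossing) : D.Arc :=
  if D.sign c = 1 then D.out c .upper else D.inn c .upper

/-- The right one of the two semiarcs of the over strand. -/
def overRight (D : Diagram) (c : D.Crossing) : D.Arc :=
  if D.sign c = 1 then D.inn c .upper else D.out c .upper

/-! ### Planarity -/

/-- The two sides of an oriented semiarc. -/
inductive Side
  | left
  | right

/-- Two sides of semiarcs that bound the same corner of a crossing. Sides are taken with respect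
to the orientation of the semiarc. -/
inductive SameCorner (D : Diagram) : D.Arc × Side → D.Arc × Side → Prop
  | left (c : D.Crossing) : SameCorner D (D.topLeft c, .right) (D.bottomLeft c, .right)
  | right (c : D.Crossing) : SameCorner D (D.topRight c, .left) (D.bottomRight c, .left)
  | top (c : D.Crossing) : SameCorner D (D.topLeft c, .left) (D.topRight c, .right)
  | bottom (c : D.Crossing) : SameCorner D (D.bottomLeft c, .left) (D.bottomRight c, .right)

/-- Two semiarcs that meet at a crossing. -/
def Meet (D : Diagram) (a b : D.Arc) : Prop :=
  ∃ c, (∃ s, a = D.inn c s ∨ a = D.out c s) ∧ ∃ s, b = D.inn c s ∨ b = D.out c s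

/-- The number of faces, counted separately for every connected piece of the diagram. -/
noncomputable def faceCount (D : Diagram) : ℕ := Nat.card (Quot D.SameCorner)

/-- The number of connected pieces of the underlying curve of the diagram. -/
noncomputable def pieceCount (D : Diagram) : ℕ := Nat.card (Quot D.Meet)

/-- Every connected piece of the diagram lies on a sphere: a piece with `V` crossings has
`2 * V` edges, so it has Euler characteristic `F - V`, which is at most `2` and equals `2` exactly
for a sphere. A crossingless closed curve has `V = 0` and two sides. -/
def IsPlanar (D : Diagram) : Prop :=
  D.faceCount = Fintype.card D.Crossing + 2 * D.pieceCount

/-! ### Reidemeister moves -/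

/-- `a` and `b` are the two semiarcs of one strand through some crossing of `T`. -/
def Through (D : Diagram) (T : Set D.Crossing) (a b : D.Arc) : Prop :=
  ∃ c ∈ T, ∃ s, a = D.inn c s ∧ b = D.out c s

/-- `D'` is (up to relabelling) what is left of `D` when the crossings of `T` are erased and every
strand through them becomes an uninterrupted semiarc. -/
structure Erasure (D D' : Diagram) (T : Set D.Crossing) where
  crossing : D'.Crossing ≃ {c : D.Crossing // c ∉ T}
  arc : D.Arc → D'.Arc
  arc_surjective : Function.Surjective arc
  arc_eq_iff : ∀ a b, arc a = arc b ↔ Relation.EqvGen (D.Through T) a b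
  sign_eq : ∀ c, D'.sign c = D.sign (crossing c)
  inn_eq : ∀ c s, D'.inn c s = arc (D.inn (crossing c) s)
  out_eq : ∀ c s, D'.out c s = arc (D.out (crossing c) s)

/-- The strand passages `p` and `q` follow each other along one semiarc, `p` first if `o = 1`, and
`q` first if `o = -1`. -/
def Follows (D : Diagram) (o : ℤˣ) (p q : D.Crossing × Strand) : Prop :=
  if o = 1 then D.out p.1 p.2 = D.inn q.1 q.2 else D.out q.1 q.2 = D.inn p.1 p.2

/-- Three strands (bottom, middle, top) bound a triangular face: at `u` the bottom strand
passes under the middle one, at `v` the middle strand under the top one, at `t` the bottom strand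
under the top one. Each strand passes its two crossings consecutively, in any order (`ob`, `om`,
`ot`) for which the three sides lie around one face; as three straight lines in the plane show, these
are the orders whose product with the sign of the opposite crossing is the same for all sides. -/
structure IsTriangle (D : Diagram) (u v t : D.Crossing) (ob om ot : ℤˣ) : Prop where
  u_ne_v : u ≠ v
  v_ne_t : v ≠ t
  u_ne_t : u ≠ t
  bottom : D.Follows ob (u, .lower) (t, .lower)
  middle : D.Follows om (u, .upper) (v, .lower)
  top : D.Follows ot (t, .upper) (v, .upper)
  bottom_middle : ob * D.sign v = om * D.sign t
  middle_top : om * D.sign t = ot * D.sign u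

/-- Exchange of the two passages of each of the three strands of a triangle. -/
def triangleSwap (D : Diagram) (u v t : D.Crossing) (p : D.Crossing × Strand) :
    D.Crossing × Strand :=
  match p with
  | (c, .lower) =>
      if c = u then (t, .lower) else if c = t then (u, .lower)
      else if c = v then (u, .upper) else (c, .lower)
  | (c, .upper) =>
      if c = u then (v, .lower) else if c = v then (t, .upper)
      else if c = t then (v, .upper) else (c, .upper)

/-- `D'` is (up to relabelling) obtained from `D` by moving the strands of the triangle across each
other: every strand passes its two crossings in the opposite order, with all signs kept. -/
structure TriangleMove (D D' : Diagram) (u v t : D.Crossing) where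
  crossing : D.Crossing ≃ D'.Crossing
  arc : D.Arc ≃ D'.Arc
  sign_eq : ∀ c, D'.sign (crossing c) = D.sign c
  inn_eq : ∀ c s, D'.inn (crossing c) s =
    arc (D.inn (D.triangleSwap u v t (c, s)).1 (D.triangleSwap u v t (c, s)).2)
  out_eq : ∀ c s, D'.out (crossing c) s =
    arc (D.out (D.triangleSwap u v t (c, s)).1 (D.triangleSwap u v t (c, s)).2)

/-- The oriented Reidemeister moves, in the simplifying direction where there is one. -/
inductive ReidemeisterMove (D D' : Diagram) : Prop
  /-- Relabelling of crossings and semiarcs (planar isotopy). -/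
  | isotopy (h : Erasure D D' ∅)
  /-- Removal of a kink: a semiarc leads from one strand of `c` directly to the other one. -/
  | one (c : D.Crossing) (s : Strand) (kink : D.out c s = D.inn c s.other)
      (h : Erasure D D' {c})
  /-- Removal of a bigon: one strand passes over another one twice, consecutively along both
  strands and with opposite signs. The strands may be parallel or antiparallel. -/
  | two (c d : D.Crossing) (sign : D.sign c = -D.sign d)
      (hover : D.out c .upper = D.inn d .upper)
      (hunder : D.out c .lower = D.inn d .lower ∨ D.out d .lower = D.inn c .lower)
      (h : Erasure D D' {c, d})
  /-- A strand moves across a crossing of two others. -/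
  | three (u v t : D.Crossing) (ob om ot : ℤˣ) (triangle : D.IsTriangle u v t ob om ot)
      (h : TriangleMove D D' u v t)

end Diagram

/-- An oriented (classical) knot or link diagram. -/
def LinkDiagram : Type 1 := {D : Diagram // D.IsPlanar}

/-- Two oriented link diagrams represent the same oriented link: they are related by a finite
sequence of Reidemeister moves and their inverses. -/
def LinkDiagram.SameLink : LinkDiagram → LinkDiagram → Prop :=
  Relation.EqvGen fun D D' => Diagram.ReidemeisterMove D.1 D'.1

/-! ### Colorings and the bracket -/

/-- An `X`-coloring of a diagram: semiarcs are labelled by elements of `X` such that at every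
crossing, with left labels `x` (under strand) and `y` (over strand), the right labels are
`underBy x y` and `overBy y x`. -/
@[ext]
structure Diagram.Coloring (D : Diagram) (X : Type*) [Biquandle X] where
  color : D.Arc → X
  under_rel : ∀ c, color (D.underRight c) =
    Biquandle.underBy (color (D.underLeft c)) (color (D.overLeft c))
  over_rel : ∀ c, color (D.overRight c) =
    Biquandle.overBy (color (D.overLeft c)) (color (D.underLeft c))

/-- The coloring `φ f` obtained by applying the endomorphism `φ` to all labels of `f`. -/
def Diagram.Coloring.map {D : Diagram} {X : Type*} [Biquandle X] (φ : BiquandleHom X X)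
    (f : D.Coloring X) : D.Coloring X where
  color a := φ.toFun (f.color a)
  under_rel c := by rw [f.under_rel, φ.map_under]
  over_rel c := by rw [f.over_rel, φ.map_over]

/-- The two smoothings of a crossing. -/
inductive Smoothing
  /-- Follows the orientation of the strands. -/
  | oriented
  /-- Joins the two incoming semiarcs, and the two outgoing ones. -/
  | disoriented

instance : DecidableEq Smoothing := fun a b => by
  cases a <;> cases b <;> first | exact isTrue rfl | exact isFalse (by simp)

instance : Fintype Smoothing := ⟨{.oriented, .disoriented}, fun x => by cases x <;> simp⟩

namespace Diagram

/-- Semiarcs that are joined at a crossing when the crossings are smoothed according to `s`. -/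
inductive Joined (D : Diagram) (s : D.Crossing → Smoothing) : D.Arc → D.Arc → Prop
  | oriented (c : D.Crossing) (h : s c = .oriented) (r : Strand) :
      Joined D s (D.inn c r) (D.out c r.other)
  | disoriented_inn (c : D.Crossing) (h : s c = .disoriented) :
      Joined D s (D.inn c .upper) (D.inn c .lower)
  | disoriented_out (c : D.Crossing) (h : s c = .disoriented) :
      Joined D s (D.out c .upper) (D.out c .lower)

/-- The number of closed curves in a Kauffman state. -/
noncomputable def loopCount (D : Diagram) (s : D.Crossing → Smoothing) : ℕ :=
  Nat.card (Quot (D.Joined s))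

/-- The writhe: positive minus negative crossings. -/
def writhe (D : Diagram) : ℤ := ∑ c, (D.sign c : ℤ)

variable {X : Type*} [Biquandle X] {R : Type*} [CommRing R]

/-- The skein coefficient of a smoothed crossing with left labels `x` (under) and `y` (over):
`A x y` or `B x y` at a positive crossing, the inverses at a negative one. -/
def skeinCoeff (β : BiquandleBracket X R) {D : Diagram} (f : D.Coloring X) (c : D.Crossing) :
    Smoothing → Rˣ
  | .oriented => β.A (f.color (D.underLeft c)) (f.color (D.overLeft c)) ^ (D.sign c : ℤ)
  | .disoriented => β.B (f.color (D.underLeft c)) (f.color (D.overLeft c)) ^ (D.sign c : ℤ)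

/-- The bracket value of an `X`-colored diagram: the state sum, with value `δ` for each closed
curve, normalised by `w` to the power minus the writhe. -/
noncomputable def bracketValue (β : BiquandleBracket X R) {D : Diagram} (f : D.Coloring X) : R :=
  ((β.w ^ (-D.writhe) : Rˣ) : R) *
    ∑ s : D.Crossing → Smoothing,
      (∏ c, (skeinCoeff β f c (s c) : R)) * β.δ ^ D.loopCount s

end Diagram

/-! ### Weighted quivers -/

/-- A directed graph (multiple edges and loops allowed) with vertices weighted in `R`. -/
structure WeightedQuiver.{u, w} (R : Type w) where
  V : Type u
  quiver : Quiver.{u} V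
  weight : V → R

/-- Isomorphism of vertex-weighted directed graphs. -/
structure WeightedQuiver.Iso {R : Type*} (P Q : WeightedQuiver R) where
  vertex : P.V ≃ Q.V
  edge : ∀ a b, P.quiver.Hom a b ≃ Q.quiver.Hom (vertex a) (vertex b)
  weight_eq : ∀ a, Q.weight (vertex a) = P.weight a

/-- The biquandle bracket quiver of a diagram: vertices are the `X`-colorings `f`, there is one edge
from `f` to `φ f` for every `φ ∈ S`, and the weights are the bracket values. -/
noncomputable def Diagram.bracketQuiver {X : Type*} [Biquandle X] {R : Type*} [CommRing R]
    (D : Diagram) (β : BiquandleBracket X R) (S : Set (BiquandleHom X X)) : WeightedQuiver R where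
  V := D.Coloring X
  quiver := { Hom := fun f g => {φ : BiquandleHom X X // φ ∈ S ∧ f.map φ = g} }
  weight := fun f => bracketValue β f

/-!
Two diagrams related by a Reidemeister move have corresponding colorings: a coloring of one side
determines a coloring of the other that has the same labels on the semiarcs that the move leaves in
place. Only the labels on these semiarcs matter for the correspondence, so it commutes with
biquandle endomorphisms, and hence a correspondence that preserves bracket values is an isomorphism
of bracket quivers (`Diagram.ColoringsCorrespond.nonempty_iso`). Everything is local at the
crossings of the move, and planarity plays no role.

*Loop counts.* The closed curves of a state are the classes of the equivalence relation generated
by its connections, that is, of a supremum of relations `Setoid.link`. The semiarcs between the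
crossings of a move are isolated points of the relation generated outside, and joining an isolated
point to another point lowers the number of classes by one (`Setoid.classCount_sup_link`). This
gives the contributions of a kink, a bigon and a triangle to a state sum. When crossings are
described by the left and right ends of their two strands, drawn downwards, the oriented smoothing
joins left to left and right to right for either sign, so that signs need not be distinguished
here.

*Kink and bigon.* A kink contributes `δ A + B` or its analogue with inverses, a power of `w`; the
two strands have equal labels because the sideways map of a finite biquandle permutes the diagonal.
In a bigon the two crossings have equal left labels and inverse coefficients, and the circle
relation cancels all states but those that separate the strands.

*Triangle.* There are sixteen configurations of signs and directions of the sides. In all of them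
the labels at the crossings before and after the move are complementary halves of the same six
pairs, which occur in the axioms of a bracket (`Biquandle.exists_pairs_of_sides`). Calling a
smoothing a corner or a pass according to whether it cuts off the corner of the triangle, the
invariance of the state sum becomes a system of equations between corner and pass coefficients, one
for each of the five ways to join the six outer ends (`Hexagon`). The system is symmetric in the
three crossings and in the two sides of the move. For three positive crossings it is the list of
axioms of a bracket; changing the sign of one crossing preserves it (`Hexagon.flip`), because this
amounts to moving an inverse crossing to the other side, and so it holds in all configurations
(`BiquandleBracket.hexagon`).
-/

/-! ### Counting the classes of equivalence relations -/

namespace Setoid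

variable {α β : Type*}

/-- The equivalence relation generated by the single pair `(a, b)`. -/
def link (a b : α) : Setoid α := Relation.EqvGen.setoid fun x y => x = a ∧ y = b

theorem link_le_iff_rel {a b : α} {S : Setoid α} : link a b ≤ S ↔ S a b := by
  constructor
  · intro h
    exact h (Relation.EqvGen.rel _ _ ⟨rfl, rfl⟩)
  · intro h
    refine Setoid.eqvGen_le ?_
    rintro x y ⟨rfl, rfl⟩
    exact h

/-- The form of `link_le_iff_rel` in which congruence closure can work with it. -/
theorem link_le_iff {a b : α} {S : Setoid α} :
    link a b ≤ S ↔ (Quotient.mk S a = Quotient.mk S b) :=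
  link_le_iff_rel.trans Quotient.eq.symm

theorem link_self (a : α) : link a a = ⊥ :=
  le_bot_iff.1 (link_le_iff_rel.2 (Setoid.refl' _ a))

theorem link_comm (a b : α) : link a b = link b a :=
  eq_of_forall_ge_iff fun S => by
    rw [link_le_iff_rel, link_le_iff_rel, S.comm']

/-- The number of classes of an equivalence relation. -/
noncomputable def classCount (S : Setoid α) : ℕ := Nat.card (Quotient S)

/-- The class of `a` is a singleton. -/
def IsolatedAt (S : Setoid α) (a : α) : Prop := S ≤ ker (· = a)

theorem IsolatedAt.eq {S : Setoid α} {a x : α} (h : S.IsolatedAt a) (hx : S a x) : x = a := by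
  have := h hx
  simpa [eq_comm] using this

theorem IsolatedAt.sup {S T : Setoid α} {a : α} (hS : S.IsolatedAt a) (hT : T.IsolatedAt a) :
    (S ⊔ T).IsolatedAt a := sup_le hS hT

theorem isolatedAt_iSup {ι : Sort*} {S : ι → Setoid α} {a : α} (h : ∀ i, (S i).IsolatedAt a) :
    (⨆ i, S i).IsolatedAt a := iSup_le h

theorem isolatedAt_link {a x y : α} (hx : x ≠ a) (hy : y ≠ a) : (link x y).IsolatedAt a :=
  link_le_iff_rel.2 (by simp [hx, hy])

/-- Joining an isolated point to another one merges exactly two classes. -/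
theorem classCount_sup_link [Finite α] {S : Setoid α} {a b : α} (ha : S.IsolatedAt a)
    (hab : b ≠ a) : (S ⊔ link a b).classCount + 1 = S.classCount := by
  classical
  let ρ : α → α := fun x => if x = a then b else x
  have hρ : S ⊔ link a b = comap ρ S := by
    apply le_antisymm
    · refine sup_le (fun x y h => ?_) (link_le_iff_rel.2 ?_)
      · by_cases hx : x = a
        · subst hx
          rw [ha.eq h]
        · have hy : y ≠ a := by
            rintro rfl
            exact hx (ha.eq (S.symm' h))
          simpa [comap_rel, ρ, hx, hy] using h
      · simp only [comap_rel, ρ, if_pos, if_neg hab]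
        exact S.refl' b
    · intro x y h
      have key : ∀ x, (S ⊔ link a b) x (ρ x) := by
        intro x
        by_cases hx : x = a
        · subst hx
          simpa [ρ] using (link_le_iff_rel.1 (le_sup_right : link x b ≤ S ⊔ link x b))
        · simp only [ρ, if_neg hx]
          exact Setoid.refl' _ x
      exact Setoid.trans' _ (key x)
        (Setoid.trans' _ ((le_sup_left : S ≤ S ⊔ link a b) h) (Setoid.symm' _ (key y)))
  have hrange : Set.range (@Quotient.mk'' _ S ∘ ρ) = {Quotient.mk'' a}ᶜ := by
    ext q
    induction q using Quotient.inductionOn' with | h x =>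
    simp only [Set.mem_range, Function.comp_apply, Set.mem_compl_iff, Set.mem_singleton_iff]
    constructor
    · rintro ⟨y, hy⟩ hx
      have hya : S a (ρ y) := S.symm' (Quotient.eq''.1 (hy.trans hx))
      have hρy := ha.eq hya
      by_cases hy : y = a
      · exact hab (by simpa only [ρ, hy, if_true] using hρy)
      · simp only [ρ, hy, if_false] at hρy
    · intro hx
      refine ⟨x, ?_⟩
      have : x ≠ a := by
        rintro rfl
        exact hx rfl
      simp [ρ, this]
  rw [classCount, classCount, hρ, Nat.card_congr (comapQuotientEquiv ρ S), hrange,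
    Nat.card_coe_set_eq, Set.ncard_compl, Set.ncard_singleton]
  have : 0 < Nat.card (Quotient S) := Nat.card_pos_iff.2 ⟨⟨Quotient.mk'' a⟩, inferInstance⟩
  omega

theorem classCount_comap {f : α → β} (hf : Function.Surjective f) (S : Setoid β) :
    (comap f S).classCount = S.classCount := by
  have : Set.range (@Quotient.mk'' _ S ∘ f) = Set.univ :=
    ((Quotient.mk''_surjective (s₁ := S)).comp hf).range_eq
  rw [classCount, Nat.card_congr (comapQuotientEquiv f S), this, classCount, Nat.card_coe_set_eq,
    Set.ncard_univ]

end Setoid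

/-! ### Smoothed crossings -/

theorem Bool.forall_of_not {P : Bool → Prop} {b : Bool} (h : P b) (h' : P !b) (x : Bool) : P x := by
  cases b <;> cases x <;> assumption

theorem Bool.apply_true_eq_apply_false {α : Type*} {g : Bool → α} {b : Bool} (h : g b = g !b) :
    g true = g false := by
  cases b
  · exact h.symm
  · exact h

/-- The smoothing that joins the end `b` of the under strand to the end `b'` of the over strand,
where `true` stands for the left and `false` for the right end. Whatever the sign of the crossing,
the oriented smoothing joins left to left and right to right. -/
def Smoothing.joining (b b' : Bool) : Smoothing := if b = b' then .oriented else .disoriented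

theorem Smoothing.joining_not_not (b b' : Bool) : joining (!b) (!b') = joining b b' := by
  cases b <;> cases b' <;> rfl

theorem Smoothing.sum_eq_joining {M : Type*} [AddCommMonoid M] (g : Smoothing → M) (b b' : Bool) :
    ∑ x, g x = g (joining b b') + g (joining b !b') := by
  have : ∑ x, g x = g .oriented + g .disoriented := by
    rw [show (Finset.univ : Finset Smoothing) = {.oriented, .disoriented} from rfl,
      Finset.sum_pair (by simp)]
  cases b <;> cases b' <;> simp [this, joining, add_comm]

namespace Setoid

variable {α : Type*}

/-- The connections made by smoothing a crossing with ends `e`. -/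
def node (e : Strand → Bool → α) : Smoothing → Setoid α
  | .oriented => link (e .lower true) (e .upper true) ⊔ link (e .lower false) (e .upper false)
  | .disoriented => link (e .lower true) (e .upper false) ⊔ link (e .lower false) (e .upper true)

theorem node_joining (e : Strand → Bool → α) (b b' : Bool) :
    node e (.joining b b') =
      link (e .lower b) (e .upper b') ⊔ link (e .lower !b) (e .upper !b') := by
  cases b <;> cases b' <;> simp [node, Smoothing.joining, sup_comm]

theorem isolatedAt_node {e : Strand → Bool → α} {a : α} (h : ∀ s b, e s b ≠ a) (x : Smoothing) :
    (node e x).IsolatedAt a := by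
  cases x <;> exact (isolatedAt_link (h _ _) (h _ _)).sup (isolatedAt_link (h _ _) (h _ _))

theorem classCount_sup_link_sup_link [Finite α] {S : Setoid α} {i j a b : α}
    (hi : S.IsolatedAt i) (hj : S.IsolatedAt j) (hij : i ≠ j)
    (hai : a ≠ i) (haj : a ≠ j) (hbj : b ≠ j) :
    (S ⊔ link i a ⊔ link j b).classCount + 2 = S.classCount := by
  have h1 := classCount_sup_link hi hai
  have h2 := classCount_sup_link (S := S ⊔ link i a) (hj.sup (isolatedAt_link hij haj)) hbj
  omega

theorem classCount_sup_link_sup_link_sup_link [Finite α] {S : Setoid α} {i j k a b c : α}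
    (hi : S.IsolatedAt i) (hj : S.IsolatedAt j) (hk : S.IsolatedAt k)
    (hij : i ≠ j) (hik : i ≠ k) (hjk : j ≠ k)
    (hai : a ≠ i) (haj : a ≠ j) (hak : a ≠ k) (hbj : b ≠ j) (hbk : b ≠ k) (hck : c ≠ k) :
    (S ⊔ link i a ⊔ link j b ⊔ link k c).classCount + 3 = S.classCount := by
  have h1 := classCount_sup_link_sup_link hi hj hij hai haj hbj
  have h2 := classCount_sup_link (S := S ⊔ link i a ⊔ link j b)
    ((hk.sup (isolatedAt_link hik hak)).sup (isolatedAt_link hjk hbk)) hck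
  omega

end Setoid

namespace Setoid

variable {α : Type*}

/-- The connections made by following the two strands through a crossing with ends `e`. -/
def through (e : Strand → Bool → α) : Setoid α :=
  link (e .lower true) (e .lower false) ⊔ link (e .upper true) (e .upper false)

theorem through_eq (e : Strand → Bool → α) (b b' : Bool) :
    through e = link (e .lower b) (e .lower !b) ⊔ link (e .upper b') (e .upper !b') := by
  cases b <;> cases b' <;> simp [through, link_comm]

end Setoid

/-! ### State sums of a kink, a bigon and a triangle

In these lemmas `E` is what a state does away from the crossings in question, the points `i`, `j`,
`k` are the semiarcs between these crossings, and the other points are the semiarcs leading to the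
outside. -/

section LocalSums

open Setoid

variable {α : Type*} [Finite α] {R : Type*} [CommRing R]

/-- Of the two smoothings of a kink, the oriented one splits off a closed curve, and the other one
straightens the kink. -/
theorem sum_smoothing_kink {E : Setoid α} {e : Strand → Bool → α} {i : α} {b : Bool}
    (hE : E.IsolatedAt i) (hl : e .lower b = i) (hu : e .upper b = i)
    (hl' : e .lower (!b) ≠ i) (hu' : e .upper (!b) ≠ i) (f : Smoothing → R) (δ : R) :
    ∑ x, f x * δ ^ (E ⊔ node e x).classCount =
      (δ * f .oriented + f .disoriented) * δ ^ (E ⊔ through e).classCount := by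
  have h0 := classCount_sup_link
    (S := E ⊔ link (e .lower !b) (e .upper !b)) (hE.sup (isolatedAt_link hl' hu')) hl'
  have h1 : E ⊔ (link i i ⊔ link (e .lower !b) (e .upper !b)) =
      E ⊔ link (e .lower !b) (e .upper !b) := by rw [link_self, bot_sup_eq]
  have h2 : E ⊔ (link i (e .upper !b) ⊔ link (e .lower !b) i) =
      E ⊔ link (e .lower !b) (e .upper !b) ⊔ link i (e .lower !b) :=
    eq_of_forall_ge_iff fun S => by
      simp only [sup_le_iff, link_le_iff]
      grind
  have h3 : E ⊔ through e =
      E ⊔ link (e .lower !b) (e .upper !b) ⊔ link i (e .lower !b) :=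
    eq_of_forall_ge_iff fun S => by
      rw [through_eq e b b, hl, hu]
      simp only [sup_le_iff, link_le_iff]
      grind
  rw [Smoothing.sum_eq_joining _ b b, node_joining, node_joining, hl, hu, Bool.not_not, hu, h1, h2,
    h3, ← h0, pow_succ]
  have : Smoothing.joining b b = .oriented := by simp [Smoothing.joining]
  rw [this]
  have : Smoothing.joining b (!b) = .disoriented := by cases b <;> rfl
  rw [this]
  ring

/-- If the coefficients of two crossings that form a bigon are inverse to each other, and `δ` has
the corresponding value, then all states cancel but those that separate the two strands. -/
theorem sum_smoothing_bigon {E : Setoid α} {e e' : Strand → Bool → α} {i j : α} {b b' : Bool}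
    (hi : E.IsolatedAt i) (hj : E.IsolatedAt j) (hij : i ≠ j)
    (hl : e .lower b = i) (hu : e .upper b' = j) (hl' : e' .lower b = i) (hu' : e' .upper b' = j)
    (hli : e .lower (!b) ≠ i) (hlj : e .lower (!b) ≠ j)
    (hui : e .upper (!b') ≠ i) (huj : e .upper (!b') ≠ j)
    (hli' : e' .lower (!b) ≠ i) (hlj' : e' .lower (!b) ≠ j)
    (hui' : e' .upper (!b') ≠ i) (huj' : e' .upper (!b') ≠ j)
    {f g : Smoothing → R} {δ : R}
    (hfg : ∀ x, f x * g x = 1)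
    (hδ : f .oriented * g .disoriented + f .disoriented * g .oriented = -δ) :
    ∑ x, ∑ y, f x * g y * δ ^ (E ⊔ node e x ⊔ node e' y).classCount =
      δ ^ (E ⊔ through e ⊔ through e').classCount := by
  set a := e .lower !b
  set c := e .upper !b'
  set a' := e' .lower !b
  set c' := e' .upper !b'
  -- the outer ends joined across the bigon, and along the strands
  set S := E ⊔ link a c ⊔ link a' c' with hS
  set T := E ⊔ link a a' ⊔ link c c' with hT
  have hSi : S.IsolatedAt i := (hi.sup (isolatedAt_link hli hui)).sup (isolatedAt_link hli' hui')
  have hSj : S.IsolatedAt j := (hj.sup (isolatedAt_link hlj huj)).sup (isolatedAt_link hlj' huj')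
  have hTi : T.IsolatedAt i := (hi.sup (isolatedAt_link hli hli')).sup (isolatedAt_link hui hui')
  have hTj : T.IsolatedAt j := (hj.sup (isolatedAt_link hlj hlj')).sup (isolatedAt_link huj huj')
  have h₁ : E ⊔ (link i j ⊔ link a c) ⊔ (link i j ⊔ link a' c') = S ⊔ link i j :=
    eq_of_forall_ge_iff fun S => by
      simp only [hS, sup_le_iff, link_le_iff]
      grind
  have h₂ : E ⊔ (link i j ⊔ link a c) ⊔ (link i c' ⊔ link a' j) = S ⊔ link i a' ⊔ link j a' :=
    eq_of_forall_ge_iff fun S => by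
      simp only [hS, sup_le_iff, link_le_iff]
      grind
  have h₃ : E ⊔ (link i c ⊔ link a j) ⊔ (link i j ⊔ link a' c') = S ⊔ link i a ⊔ link j a :=
    eq_of_forall_ge_iff fun S => by
      simp only [hS, sup_le_iff, link_le_iff]
      grind
  have h₄ : E ⊔ (link i c ⊔ link a j) ⊔ (link i c' ⊔ link a' j) = T ⊔ link i c ⊔ link j a :=
    eq_of_forall_ge_iff fun S => by
      simp only [hT, sup_le_iff, link_le_iff]
      grind
  have h₅ : E ⊔ through e ⊔ through e' = T ⊔ link i a ⊔ link j c :=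
    eq_of_forall_ge_iff fun S => by
      rw [through_eq e b b', through_eq e' b b', hl, hu, hl', hu']
      simp only [hT, sup_le_iff, link_le_iff]
      grind
  have c₁ := classCount_sup_link hSi hij.symm
  have c₂ := classCount_sup_link_sup_link hSi hSj hij hli' hlj' hlj'
  have c₃ := classCount_sup_link_sup_link hSi hSj hij hli hlj hlj
  have c₄ := classCount_sup_link_sup_link hTi hTj hij hui huj hlj
  have c₅ := classCount_sup_link_sup_link hTi hTj hij hli hlj huj
  have e₃ : (S ⊔ link i a ⊔ link j a).classCount = (S ⊔ link i a' ⊔ link j a').classCount := by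
    omega
  have e₁ : (S ⊔ link i j).classCount = (S ⊔ link i a' ⊔ link j a').classCount + 1 := by omega
  have e₅ : (T ⊔ link i a ⊔ link j c).classCount = (T ⊔ link i c ⊔ link j a).classCount := by
    omega
  have hδ' : f (.joining b b') * g (.joining b !b') + f (.joining b !b') * g (.joining b b') = -δ := by
    rw [← hδ]
    cases b <;> cases b' <;> simp [Smoothing.joining, add_comm]
  simp only [Smoothing.sum_eq_joining _ b b', node_joining, hl, hu, hl', hu', Bool.not_not]
  change f (.joining b b') * g (.joining b b') *
        δ ^ (E ⊔ (link i j ⊔ link a c) ⊔ (link i j ⊔ link a' c')).classCount +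
      f (.joining b b') * g (.joining b !b') *
        δ ^ (E ⊔ (link i j ⊔ link a c) ⊔ (link i c' ⊔ link a' j)).classCount +
      (f (.joining b !b') * g (.joining b b') *
        δ ^ (E ⊔ (link i c ⊔ link a j) ⊔ (link i j ⊔ link a' c')).classCount +
      f (.joining b !b') * g (.joining b !b') *
        δ ^ (E ⊔ (link i c ⊔ link a j) ⊔ (link i c' ⊔ link a' j)).classCount) = _
  rw [h₁, h₂, h₃, h₄, h₅, e₁, e₃, e₅, hfg, hfg, pow_succ]
  linear_combination δ ^ (S ⊔ link i a' ⊔ link j a').classCount * hδ'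

/-- The state sum of a triangle with sides `i` (bottom strand), `j` (middle strand) and `k` (top
strand), sorted by the way in which the outer ends are joined. At the crossing of the bottom with
the middle strand the outer ends are `bu` and `mu`, at that of the middle with the top strand they
are `mv` and `tv`, at that of the bottom with the top strand they are `bt` and `tt`. The
coefficients `κ` belong to the smoothings that cut off the corner of the triangle, the coefficients
`π` to those that do not. -/
theorem sum_smoothing_triangle {E : Setoid α} {i j k bu mu mv tv bt tt : α}
    (hi : E.IsolatedAt i) (hj : E.IsolatedAt j) (hk : E.IsolatedAt k)
    (hij : i ≠ j) (hik : i ≠ k) (hjk : j ≠ k)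
    (hbu : bu ≠ i ∧ bu ≠ j ∧ bu ≠ k) (hmu : mu ≠ i ∧ mu ≠ j ∧ mu ≠ k)
    (hmv : mv ≠ i ∧ mv ≠ j ∧ mv ≠ k) (htv : tv ≠ i ∧ tv ≠ j ∧ tv ≠ k)
    (hbt : bt ≠ i ∧ bt ≠ j ∧ bt ≠ k) (htt : tt ≠ i ∧ tt ≠ j ∧ tt ≠ k)
    {eu ev et : Strand → Bool → α} {xu yu xv yv xt yt : Bool}
    (hu : eu .lower xu = i ∧ eu .upper yu = j ∧ eu .lower (!xu) = bu ∧ eu .upper (!yu) = mu)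
    (hv : ev .lower xv = j ∧ ev .upper yv = k ∧ ev .lower (!xv) = mv ∧ ev .upper (!yv) = tv)
    (ht : et .lower xt = i ∧ et .upper yt = k ∧ et .lower (!xt) = bt ∧ et .upper (!yt) = tt)
    {fu fv ft : Smoothing → R} {δ κu πu κv πv κt πt : R}
    (hκu : fu (.joining xu yu) = κu) (hπu : fu (.joining xu !yu) = πu)
    (hκv : fv (.joining xv yv) = κv) (hπv : fv (.joining xv !yv) = πv)
    (hκt : ft (.joining xt yt) = κt) (hπt : ft (.joining xt !yt) = πt) :
    ∑ x, ∑ y, ∑ z, fu x * fv y * ft z *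
        δ ^ (E ⊔ node eu x ⊔ node ev y ⊔ node et z).classCount =
      (δ * κu * κv * κt + πu * κv * κt + κu * πv * κt + κu * κv * πt) *
          δ ^ ((E ⊔ link bu mu ⊔ link mv tv ⊔ link bt tt).classCount - 3) +
        πu * πv * πt * δ ^ ((E ⊔ link mu tt ⊔ link bu tv ⊔ link mv bt).classCount - 3) +
        κu * πv * πt * δ ^ ((E ⊔ link bu mu ⊔ link tv tt ⊔ link mv bt).classCount - 3) +
        πu * κv * πt * δ ^ ((E ⊔ link mu tt ⊔ link mv tv ⊔ link bu bt).classCount - 3) +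
        πu * πv * κt * δ ^ ((E ⊔ link mu mv ⊔ link bu tv ⊔ link bt tt).classCount - 3) := by
  obtain ⟨hu1, hu2, hu3, hu4⟩ := hu
  obtain ⟨hv1, hv2, hv3, hv4⟩ := hv
  obtain ⟨ht1, ht2, ht3, ht4⟩ := ht
  have iso : ∀ {a b c d e f : α}, (a ≠ i ∧ a ≠ j ∧ a ≠ k) → (b ≠ i ∧ b ≠ j ∧ b ≠ k) →
      (c ≠ i ∧ c ≠ j ∧ c ≠ k) → (d ≠ i ∧ d ≠ j ∧ d ≠ k) → (e ≠ i ∧ e ≠ j ∧ e ≠ k) →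
      (f ≠ i ∧ f ≠ j ∧ f ≠ k) → (E ⊔ link a b ⊔ link c d ⊔ link e f).IsolatedAt i ∧
      (E ⊔ link a b ⊔ link c d ⊔ link e f).IsolatedAt j ∧
      (E ⊔ link a b ⊔ link c d ⊔ link e f).IsolatedAt k := by
    intro a b c d e f ha hb hc hd he hf
    exact ⟨((hi.sup (isolatedAt_link ha.1 hb.1)).sup (isolatedAt_link hc.1 hd.1)).sup
        (isolatedAt_link he.1 hf.1),
      ((hj.sup (isolatedAt_link ha.2.1 hb.2.1)).sup (isolatedAt_link hc.2.1 hd.2.1)).sup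
        (isolatedAt_link he.2.1 hf.2.1),
      ((hk.sup (isolatedAt_link ha.2.2 hb.2.2)).sup (isolatedAt_link hc.2.2 hd.2.2)).sup
        (isolatedAt_link he.2.2 hf.2.2)⟩
  -- the three sides hang on outer ends, so they do not contribute closed curves of their own
  have hang : ∀ {S S' : Setoid α} {a b c : α}, (S.IsolatedAt i ∧ S.IsolatedAt j ∧ S.IsolatedAt k) →
      (a ≠ i ∧ a ≠ j ∧ a ≠ k) → (b ≠ i ∧ b ≠ j ∧ b ≠ k) → (c ≠ i ∧ c ≠ j ∧ c ≠ k) →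
      S' = S ⊔ link i a ⊔ link j b ⊔ link k c → S'.classCount = S.classCount - 3 := by
    intro S S' a b c hS ha hb hc h
    have := classCount_sup_link_sup_link_sup_link hS.1 hS.2.1 hS.2.2 hij hik hjk ha.1 ha.2.1 ha.2.2
      hb.2.1 hb.2.2 hc.2.2
    rw [h]
    omega
  have isoc := iso hbu hmu hmv htv hbt htt
  have nccc : (E ⊔ (link i j ⊔ link bu mu) ⊔ (link j k ⊔ link mv tv) ⊔
      (link i k ⊔ link bt tt)).classCount =
      (E ⊔ link bu mu ⊔ link mv tv ⊔ link bt tt).classCount - 3 + 1 := by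
    have h1 := classCount_sup_link_sup_link_sup_link isoc.1 isoc.2.1 isoc.2.2 hij hik hjk
      hbu.1 hbu.2.1 hbu.2.2 hbu.2.1 hbu.2.2 hbu.2.2
    have h2 := classCount_sup_link isoc.2.1 hjk.symm
    have h3 := classCount_sup_link (isoc.1.sup (isolatedAt_link hij.symm hik.symm)) hij.symm
    rw [show E ⊔ (link i j ⊔ link bu mu) ⊔ (link j k ⊔ link mv tv) ⊔ (link i k ⊔ link bt tt) =
      E ⊔ link bu mu ⊔ link mv tv ⊔ link bt tt ⊔ link j k ⊔ link i j from
      eq_of_forall_ge_iff fun S => by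
        simp only [sup_le_iff, link_le_iff]
        grind]
    omega
  have npcc : (E ⊔ (link i mu ⊔ link bu j) ⊔ (link j k ⊔ link mv tv) ⊔
      (link i k ⊔ link bt tt)).classCount =
      (E ⊔ link bu mu ⊔ link mv tv ⊔ link bt tt).classCount - 3 :=
    hang isoc hbu hbu hbu <| eq_of_forall_ge_iff fun S => by
      simp only [sup_le_iff, link_le_iff]
      grind
  have ncpc : (E ⊔ (link i j ⊔ link bu mu) ⊔ (link j tv ⊔ link mv k) ⊔
      (link i k ⊔ link bt tt)).classCount =
      (E ⊔ link bu mu ⊔ link mv tv ⊔ link bt tt).classCount - 3 :=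
    hang isoc hmv hmv hmv <| eq_of_forall_ge_iff fun S => by
      simp only [sup_le_iff, link_le_iff]
      grind
  have nccp : (E ⊔ (link i j ⊔ link bu mu) ⊔ (link j k ⊔ link mv tv) ⊔
      (link i tt ⊔ link bt k)).classCount =
      (E ⊔ link bu mu ⊔ link mv tv ⊔ link bt tt).classCount - 3 :=
    hang isoc hbt hbt hbt <| eq_of_forall_ge_iff fun S => by
      simp only [sup_le_iff, link_le_iff]
      grind
  have nppp : (E ⊔ (link i mu ⊔ link bu j) ⊔ (link j tv ⊔ link mv k) ⊔
      (link i tt ⊔ link bt k)).classCount =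
      (E ⊔ link mu tt ⊔ link bu tv ⊔ link mv bt).classCount - 3 :=
    hang (iso hmu htt hbu htv hmv hbt) hmu hbu hmv <| eq_of_forall_ge_iff fun S => by
      simp only [sup_le_iff, link_le_iff]
      grind
  have ncpp : (E ⊔ (link i j ⊔ link bu mu) ⊔ (link j tv ⊔ link mv k) ⊔
      (link i tt ⊔ link bt k)).classCount =
      (E ⊔ link bu mu ⊔ link tv tt ⊔ link mv bt).classCount - 3 :=
    hang (iso hbu hmu htv htt hmv hbt) htv htv hmv <| eq_of_forall_ge_iff fun S => by
      simp only [sup_le_iff, link_le_iff]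
      grind
  have npcp : (E ⊔ (link i mu ⊔ link bu j) ⊔ (link j k ⊔ link mv tv) ⊔
      (link i tt ⊔ link bt k)).classCount =
      (E ⊔ link mu tt ⊔ link mv tv ⊔ link bu bt).classCount - 3 :=
    hang (iso hmu htt hmv htv hbu hbt) hmu hbu hbu <| eq_of_forall_ge_iff fun S => by
      simp only [sup_le_iff, link_le_iff]
      grind
  have nppc : (E ⊔ (link i mu ⊔ link bu j) ⊔ (link j tv ⊔ link mv k) ⊔
      (link i k ⊔ link bt tt)).classCount =
      (E ⊔ link mu mv ⊔ link bu tv ⊔ link bt tt).classCount - 3 :=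
    hang (iso hmu hmv hbu htv hbt htt) hmu hbu hmu <| eq_of_forall_ge_iff fun S => by
      simp only [sup_le_iff, link_le_iff]
      grind
  have expand : ∀ G : Smoothing → Smoothing → Smoothing → R, ∑ x, ∑ y, ∑ z, G x y z =
      ∑ x ∈ {.joining xu yu, .joining xu !yu}, ∑ y ∈ {.joining xv yv, .joining xv !yv},
        ∑ z ∈ {.joining xt yt, .joining xt !yt}, G x y z := by
    have univ_eq : ∀ b b', (Finset.univ : Finset Smoothing) = {.joining b b', .joining b !b'} := by
      decide
    intro G
    rw [← univ_eq, ← univ_eq, ← univ_eq]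
  have ne : ∀ b b', Smoothing.joining b b' ≠ .joining b !b' := by decide
  rw [expand]
  simp only [Finset.sum_pair (ne _ _)]
  simp only [node_joining, hu1, hu2, hu3, hu4, hv1, hv2, hv3, hv4, ht1, ht2, ht3, ht4, Bool.not_not,
    hκu, hκv, hκt, hπu, hπv, hπt, nccc, npcc, ncpc, nccp, nppp, ncpp, npcp, nppc, pow_succ]
  ring

end LocalSums

/-! ### State sums -/

section StateSums

open Setoid Function

variable {C α R : Type*}

/-- The connections made by the state `s` at the crossings outside `T`. -/
def outerSetoid (e : C → Strand → Bool → α) (T : Finset C) (s : C → Smoothing) : Setoid α :=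
  ⨆ c, ⨆ _ : c ∉ T, node (e c) (s c)

/-- The points that are not ends of crossings outside `T` are isolated outside `T`. -/
def IsOuter (e : C → Strand → Bool → α) (T : Finset C) (E : Setoid α) : Prop :=
  ∀ a, (∀ c ∉ T, ∀ s b, e c s b ≠ a) → E.IsolatedAt a

theorem isOuter_outerSetoid (e : C → Strand → Bool → α) (T : Finset C) (s : C → Smoothing) :
    IsOuter e T (outerSetoid e T s) := fun _ h =>
  isolatedAt_iSup fun c => isolatedAt_iSup fun hc => isolatedAt_node (h c hc) _

variable [Fintype C] [DecidableEq C] [CommRing R]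

/-- The state sum of abstract crossings `C` with ends `e` and skein coefficients `f`. -/
noncomputable def stateSum (e : C → Strand → Bool → α) (f : C → Smoothing → R) (δ : R) : R :=
  ∑ s : C → Smoothing, (∏ c, f c (s c)) * δ ^ (⨆ c, node (e c) (s c)).classCount

/-- The sum over the states of the crossings outside `T`, in which the contribution of `T` is given
as a function `F` of the connections made outside. The states of the crossings outside `T` are
encoded as those states of all crossings that are oriented on `T`. -/
noncomputable def outerSum (e : C → Strand → Bool → α) (f : C → Smoothing → R) (T : Finset C)
    (F : Setoid α → R) : R :=
  ∑ s : C → Smoothing with ∀ c ∈ T, s c = .oriented,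
    (∏ c ∈ Tᶜ, f c (s c)) * F (outerSetoid e T s)

theorem stateSum_eq_outerSum (e : C → Strand → Bool → α) (f : C → Smoothing → R) (δ : R) :
    stateSum e f δ = outerSum e f ∅ fun E => δ ^ E.classCount := by
  simp [stateSum, outerSum, outerSetoid]

theorem Finset.sum_filter_eq_sum_sum_update {S M : Type*} [Fintype S] [DecidableEq S]
    [AddCommMonoid M] (c : C) (x₀ : S) (p : (C → S) → Prop) [DecidablePred p]
    (hp : ∀ s x, p (update s c x) ↔ p s) (H : (C → S) → M) :
    ∑ s with p s, H s = ∑ s with p s ∧ s c = x₀, ∑ x, H (update s c x) := by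
  rw [← Finset.sum_product']
  symm
  refine Finset.sum_nbij' (fun q => update q.1 c q.2) (fun s => (update s c x₀, s c)) ?_ ?_ ?_ ?_ ?_
  · rintro ⟨s, x⟩ h
    simpa [hp] using (by simpa using h : p s ∧ s c = x₀).1
  · intro s h
    simpa [hp] using h
  · rintro ⟨s, x⟩ h
    have h : p s ∧ s c = x₀ := by simpa using h
    simp [← h.2]
  · intro s _
    simp
  · intro q _
    rfl

/-- The state sum is computed crossing by crossing. -/
theorem outerSum_eq_outerSum_insert (e : C → Strand → Bool → α) (f : C → Smoothing → R)
    {T : Finset C} {c : C} (hc : c ∉ T) (F : Setoid α → R) :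
    outerSum e f T F =
      outerSum e f (insert c T) fun E => ∑ x, f c x * F (E ⊔ node (e c) x) := by
  rw [outerSum, Finset.sum_filter_eq_sum_sum_update c .oriented]
  · rw [outerSum]
    refine Finset.sum_congr ?_ fun s _ => ?_
    · ext s
      simp [and_comm]
    · rw [Finset.mul_sum]
      refine Finset.sum_congr rfl fun x _ => ?_
      have hprod : ∏ d ∈ Tᶜ, f d (update s c x d) =
          f c x * ∏ d ∈ (insert c T)ᶜ, f d (s d) := by
        have : Tᶜ = insert c (insert c T)ᶜ := by
          ext d
          by_cases hd : d = c
          · simp [hd, hc]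
          · simp [hd]
        rw [this, Finset.prod_insert (by simp), update_self]
        congr 1
        refine Finset.prod_congr rfl fun d hd => ?_
        rw [update_of_ne]
        rintro rfl
        simp at hd
      have houter : outerSetoid e T (update s c x) =
          outerSetoid e (insert c T) s ⊔ node (e c) x := by
        apply le_antisymm
        · refine iSup₂_le fun d hd => ?_
          by_cases h : d = c
          · subst h
            rw [update_self]
            exact le_sup_right
          · rw [update_of_ne h]
            exact le_sup_of_le_left (le_iSup₂_of_le d (by simp [h, hd]) le_rfl)
        · refine sup_le (iSup₂_le fun d hd => ?_) (le_iSup₂_of_le c hc (by rw [update_self]))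
          refine le_iSup₂_of_le d (fun h => hd (Finset.mem_insert_of_mem h)) ?_
          rw [update_of_ne]
          rintro rfl
          simp at hd
      rw [hprod, houter]
      ring
  · intro s x
    refine forall₂_congr fun d hd => ?_
    rw [update_of_ne]
    rintro rfl
    exact hc hd

theorem outerSum_congr {e e' : C → Strand → Bool → α} {f f' : C → Smoothing → R}
    {T : Finset C} {F F' : Setoid α → R} (he : ∀ c ∉ T, e c = e' c) (hf : ∀ c ∉ T, f c = f' c)
    (hF : ∀ E, IsOuter e T E → F E = F' E) : outerSum e f T F = outerSum e' f' T F' := by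
  refine Finset.sum_congr rfl fun s _ => ?_
  have h1 : ∏ c ∈ Tᶜ, f c (s c) = ∏ c ∈ Tᶜ, f' c (s c) :=
    Finset.prod_congr rfl fun c hc => by rw [hf c (by simpa using hc)]
  have h2 : outerSetoid e T s = outerSetoid e' T s :=
    iSup_congr fun c => iSup_congr fun hc => by rw [he c hc]
  rw [h1, hF _ (isOuter_outerSetoid e T s), h2]

theorem outerSum_const_mul (e : C → Strand → Bool → α) (f : C → Smoothing → R) (T : Finset C)
    (a : R) (F : Setoid α → R) :
    outerSum e f T (fun E => a * F E) = a * outerSum e f T F := by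
  rw [outerSum, outerSum, Finset.mul_sum]
  refine Finset.sum_congr rfl fun s _ => ?_
  ring

/-- Erasing the crossings of `T` amounts to following the two strands through each of them. -/
theorem outerSum_through_eq_stateSum {C' α' : Type*} [Fintype C'] [DecidableEq C']
    {e : C → Strand → Bool → α} {f : C → Smoothing → R} {T : Finset C}
    {e' : C' → Strand → Bool → α'} {f' : C' → Smoothing → R}
    (crossing : C' ≃ {c : C // c ∉ T}) (arc : α → α') (harc : Surjective arc)
    (hker : ker arc = ⨆ c ∈ T, through (e c))
    (he : ∀ c s b, e' c s b = arc (e (crossing c) s b)) (hf : ∀ c, f' c = f (crossing c)) (δ : R) :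
    (outerSum e f T fun E => δ ^ (E ⊔ ⨆ c ∈ T, through (e c)).classCount) = stateSum e' f' δ := by
  refine Finset.sum_bij' (fun s _ c => s (crossing c))
    (fun s' _ c => if h : c ∉ T then s' (crossing.symm ⟨c, h⟩) else .oriented) ?_ ?_ ?_ ?_ ?_
  · simp
  · intro s' _
    simp +contextual
  · intro s hs
    ext c
    by_cases h : c ∈ T
    · simp [h, (Finset.mem_filter.1 hs).2 c h]
    · simp [h]
  · intro s' _
    ext c
    have h : (crossing c : C) ∉ T := (crossing c).2
    simp [h]
  · intro s _
    have hprod : ∏ c ∈ Tᶜ, f c (s c) = ∏ c, f' c (s (crossing c)) := by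
      simp only [hf]
      rw [Equiv.prod_comp crossing fun c => f c (s c)]
      exact Finset.prod_subtype _ (by simp) _
    have hcount : comap arc (⨆ c, node (e' c) (s (crossing c))) =
        outerSetoid e T s ⊔ ⨆ c ∈ T, through (e c) := by
      rw [← hker]
      apply le_antisymm
      · have hx : ∀ x, (outerSetoid e T s ⊔ ker arc) x (surjInv harc (arc x)) := fun x =>
          (le_sup_right : ker arc ≤ _) (ker_def.2 (surjInv_eq harc (arc x)).symm)
        -- the relation on the right descends to `α'`
        have key : ∀ x y, outerSetoid e T s x y →
            comap (surjInv harc) (outerSetoid e T s ⊔ ker arc) (arc x) (arc y) := by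
          intro x y hxy
          rw [comap_rel]
          exact Setoid.trans' _ (Setoid.symm' _ (hx x)) (Setoid.trans' _
            ((le_sup_left : outerSetoid e T s ≤ _) hxy) (hx y))
        have hle : ⨆ c, node (e' c) (s (crossing c)) ≤
            comap (surjInv harc) (outerSetoid e T s ⊔ ker arc) := by
          refine iSup_le fun c => ?_
          have hnode : node (e (crossing c)) (s (crossing c)) ≤ outerSetoid e T s :=
            le_iSup₂_of_le (crossing c : C) (crossing c).2 le_rfl
          revert hnode
          cases s (crossing c) <;> intro hnode
          all_goals
            simp only [node, he, sup_le_iff, link_le_iff_rel] at hnode ⊢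
            exact ⟨key _ _ hnode.1, key _ _ hnode.2⟩
        intro x y hxy
        exact Setoid.trans' _ (hx x) (Setoid.trans' _ (hle hxy) (Setoid.symm' _ (hx y)))
      · refine sup_le (iSup₂_le fun c hc => ?_) fun x y hxy => ?_
        · have hnode : node (e' (crossing.symm ⟨c, hc⟩)) (s c) ≤
              ⨆ c, node (e' c) (s (crossing c)) :=
            le_iSup_of_le (crossing.symm ⟨c, hc⟩) (by simp)
          revert hnode
          cases s c <;> intro hnode
          all_goals
            simp only [node, he, sup_le_iff, link_le_iff_rel, Equiv.apply_symm_apply] at hnode ⊢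
            exact hnode
        · have : arc x = arc y := hxy
          rw [comap_rel, this]
    rw [hprod]
    simp only [← hcount, classCount_comap harc]

end StateSums

/-! ### Skein coefficients around a triangle -/

section Hexagon

variable {R : Type*} [CommRing R]

/-- The skein coefficients of the two crossings, before and after a triangle move, of a pair of
strands: `κ` and `π` belong to the smoothings that do and do not cut off the corner of the triangle
before the move, `κ'` and `π'` to those after it. -/
structure CornerCoeffs (R : Type*) [CommRing R] where
  κ : Rˣ
  π : Rˣ
  κ' : Rˣ
  π' : Rˣ

namespace CornerCoeffs

/-- The coefficients of the inverse move. -/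
def symm (a : CornerCoeffs R) : CornerCoeffs R := ⟨a.κ', a.π', a.κ, a.π⟩

/-- The coefficients after the inverse crossings have been moved to the other sides. -/
def flip (a : CornerCoeffs R) : CornerCoeffs R := ⟨a.κ'⁻¹, a.π'⁻¹, a.κ⁻¹, a.π⁻¹⟩

/-- The coefficients with the roles of the two smoothings exchanged. -/
def swap (a : CornerCoeffs R) : CornerCoeffs R := ⟨a.π, a.κ, a.π', a.κ'⟩

end CornerCoeffs

/-- The equations between the skein coefficients of three pairs of strands which make the state sum
invariant under a triangle move: apart from the circle relations there is one for each way of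
joining the six outer ends. -/
structure Hexagon (δ : R) (a b c : CornerCoeffs R) : Prop where
  circle_a : δ * a.κ * a.π = -((a.κ : R) ^ 2 + (a.π : R) ^ 2)
  circle_a' : δ * a.κ' * a.π' = -((a.κ' : R) ^ 2 + (a.π' : R) ^ 2)
  circle_b : δ * b.κ * b.π = -((b.κ : R) ^ 2 + (b.π : R) ^ 2)
  circle_b' : δ * b.κ' * b.π' = -((b.κ' : R) ^ 2 + (b.π' : R) ^ 2)
  circle_c : δ * c.κ * c.π = -((c.κ : R) ^ 2 + (c.π : R) ^ 2)
  circle_c' : δ * c.κ' * c.π' = -((c.κ' : R) ^ 2 + (c.π' : R) ^ 2)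
  corner_a : (a.κ * b.π * c.π : R) = a.κ' * b.π' * c.π'
  corner_b : (a.π * b.κ * c.π : R) = a.π' * b.κ' * c.π'
  corner_c : (a.π * b.π * c.κ : R) = a.π' * b.π' * c.κ'
  pass : (a.π * b.π * c.π : R) = δ * a.κ' * b.κ' * c.κ' + a.π' * b.κ' * c.κ' +
    a.κ' * b.π' * c.κ' + a.κ' * b.κ' * c.π'
  pass' : (a.π' * b.π' * c.π' : R) = δ * a.κ * b.κ * c.κ + a.π * b.κ * c.κ +
    a.κ * b.π * c.κ + a.κ * b.κ * c.π

namespace Hexagon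

variable {δ : R} {a b c : CornerCoeffs R}

theorem symm (h : Hexagon δ a b c) : Hexagon δ a.symm b.symm c.symm :=
  ⟨h.circle_a', h.circle_a, h.circle_b', h.circle_b, h.circle_c', h.circle_c,
    h.corner_a.symm, h.corner_b.symm, h.corner_c.symm, h.pass', h.pass⟩

theorem rotate (h : Hexagon δ a b c) : Hexagon δ b c a where
  circle_a := h.circle_b
  circle_a' := h.circle_b'
  circle_b := h.circle_c
  circle_b' := h.circle_c'
  circle_c := h.circle_a
  circle_c' := h.circle_a'
  corner_a := by linear_combination h.corner_b
  corner_b := by linear_combination h.corner_c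
  corner_c := by linear_combination h.corner_a
  pass := by linear_combination h.pass
  pass' := by linear_combination h.pass'

/-- A consequence of the equations in which `δ` has been eliminated. -/
theorem corner_relation (h : Hexagon δ a b c) :
    (a.κ * (a.κ * b.κ * c.κ) : R) =
      a.π' * (a.κ * (b.π' * c.κ' + b.κ' * c.π') - a.π * b.π' * c.π') := by
  linear_combination (a.π : R) * h.pass' + b.κ * c.κ * h.circle_a +
    a.κ * h.corner_b + a.κ * h.corner_c

/-- The cutting smoothings have the same product before and after the move. -/
theorem corner_product (h : Hexagon δ a b c) : (a.κ * b.κ * c.κ : R) = a.κ' * b.κ' * c.κ' := by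
  have h1 := h.corner_relation
  have h2 : (a.κ' * (a.κ' * b.κ' * c.κ') : R) =
    a.π * (a.κ' * (b.π * c.κ + b.κ * c.π) - a.π' * b.π * c.π) := h.symm.corner_relation
  refine (Units.mul_right_inj (a.κ * a.κ')).1 ?_
  push_cast
  linear_combination (a.κ' : R) * h1 - a.κ * h2 - a.κ * a.κ' * (h.corner_b + h.corner_c) +
    a.π * a.π' * h.corner_a

/-- The equation `Hexagon.pass` for the flipped coefficients. -/
theorem flip_pass (h : Hexagon δ a b c) :
    ((a.π'⁻¹ : Rˣ) * b.κ * c.κ : R) = δ * (a.κ⁻¹ : Rˣ) * b.π' * c.π' +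
      (a.π⁻¹ : Rˣ) * b.π' * c.π' + (a.κ⁻¹ : Rˣ) * b.κ' * c.π' + (a.κ⁻¹ : Rˣ) * b.π' * c.κ' := by
  have h1 := h.corner_relation
  have hκ := Units.mul_inv a.κ
  have hπ := Units.mul_inv a.π
  have hπ' := Units.mul_inv a.π'
  refine (Units.mul_right_inj (a.κ * a.κ * a.π * a.π')).1 ?_
  push_cast
  linear_combination (a.π : R) * h1 + a.κ * a.κ * a.π * b.κ * c.κ * hπ' -
    a.κ * a.π' * a.π * (δ * b.π' * c.π' + b.κ' * c.π' + b.π' * c.κ') * hκ -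
    a.κ * a.κ * a.π' * b.π' * c.π' * hπ - a.π' * b.π' * c.π' * h.circle_a

theorem circle_inv {k p : Rˣ} (h : δ * k * p = -((k : R) ^ 2 + (p : R) ^ 2)) :
    δ * (k⁻¹ : Rˣ) * (p⁻¹ : Rˣ) = -(((k⁻¹ : Rˣ) : R) ^ 2 + ((p⁻¹ : Rˣ) : R) ^ 2) := by
  have hk := Units.mul_inv k
  have hp := Units.mul_inv p
  refine (Units.mul_right_inj (k * k * p * p)).1 ?_
  push_cast
  linear_combination h + (δ * k * p + (p : R) ^ 2 * (1 + (k : R) * (k⁻¹ : Rˣ))) * hk +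
    (δ * k * p * (k * (k⁻¹ : Rˣ)) + (k : R) ^ 2 * (1 + (p : R) * (p⁻¹ : Rˣ))) * hp

theorem circle_swap {k p : Rˣ} (h : δ * k * p = -((k : R) ^ 2 + (p : R) ^ 2)) :
    δ * p * k = -((p : R) ^ 2 + (k : R) ^ 2) := by linear_combination h

/-- Reversing the sign of one pair of crossings preserves the equations, since these say
that the move can be undone by moving an inverse crossing to the other side. -/
theorem flip (h : Hexagon δ a b c) : Hexagon δ a.flip b.swap c.swap where
  circle_a := circle_inv h.circle_a'
  circle_a' := circle_inv h.circle_a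
  circle_b := circle_swap h.circle_b
  circle_b' := circle_swap h.circle_b'
  circle_c := circle_swap h.circle_c
  circle_c' := circle_swap h.circle_c'
  corner_a := by
    have h1 := h.corner_product
    have hκ := Units.mul_inv a.κ
    have hκ' := Units.mul_inv a.κ'
    refine (Units.mul_right_inj (a.κ * a.κ')).1 ?_
    simp only [CornerCoeffs.flip, CornerCoeffs.swap]
    push_cast
    linear_combination h1 + a.κ * b.κ * c.κ * hκ' - a.κ' * b.κ' * c.κ' * hκ
  corner_b := by
    have h1 := h.corner_c
    have hπ := Units.mul_inv a.π
    have hπ' := Units.mul_inv a.π'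
    refine (Units.mul_right_inj (a.π * a.π')).1 ?_
    simp only [CornerCoeffs.flip, CornerCoeffs.swap]
    push_cast
    linear_combination h1 + a.π * b.π * c.κ * hπ' - a.π' * b.π' * c.κ' * hπ
  corner_c := by
    have h1 := h.corner_b
    have hπ := Units.mul_inv a.π
    have hπ' := Units.mul_inv a.π'
    refine (Units.mul_right_inj (a.π * a.π')).1 ?_
    simp only [CornerCoeffs.flip, CornerCoeffs.swap]
    push_cast
    linear_combination h1 + a.π * b.κ * c.π * hπ' - a.π' * b.κ' * c.π' * hπ
  pass := by
    simp only [CornerCoeffs.flip, CornerCoeffs.swap]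
    linear_combination h.flip_pass
  pass' := by
    have := h.symm.flip_pass
    simp only [CornerCoeffs.symm] at this
    simp only [CornerCoeffs.flip, CornerCoeffs.swap]
    linear_combination this

end Hexagon

end Hexagon

namespace BiquandleBracket

open Biquandle

variable {X : Type*} [Biquandle X] {R : Type*} [CommRing R] (β : BiquandleBracket X R)

/-- The skein coefficients of a crossing with sign `ε` and left labels `q`. -/
def coeff (ε : ℤˣ) (q : X × X) : Smoothing → Rˣ
  | .oriented => β.A q.1 q.2 ^ (ε : ℤ)
  | .disoriented => β.B q.1 q.2 ^ (ε : ℤ)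

/-- The circle relation, cleared of denominators. -/
theorem circle_mul (q : X × X) : β.δ * β.A q.1 q.2 * β.B q.1 q.2 =
    -((β.A q.1 q.2 : R) ^ 2 + (β.B q.1 q.2 : R) ^ 2) := by
  have hA := Units.mul_inv (β.A q.1 q.2)
  have hB := Units.mul_inv (β.B q.1 q.2)
  rw [← β.circle q.1 q.2]
  linear_combination -(β.B q.1 q.2 : R) ^ 2 * hA - (β.A q.1 q.2 : R) ^ 2 * hB

theorem coeff_mul_coeff_neg (ε : ℤˣ) (q : X × X) (x : Smoothing) :
    β.coeff ε q x * β.coeff (-ε) q x = 1 := by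
  cases x <;> simp [coeff]

/-- The circle relation at a crossing of either sign. -/
theorem coeff_cross (ε : ℤˣ) (q : X × X) :
    (β.coeff ε q .oriented * β.coeff (-ε) q .disoriented +
      β.coeff ε q .disoriented * β.coeff (-ε) q .oriented : R) = -β.δ := by
  have := β.circle q.1 q.2
  rcases Int.units_eq_one_or ε with rfl | rfl <;> simp [coeff] <;> linear_combination -this

/-- A kink contributes a power of `w`. -/
theorem coeff_kink (ε : ℤˣ) (x : X) :
    β.δ * β.coeff ε (x, x) .oriented + β.coeff ε (x, x) .disoriented =
      ((β.w ^ (ε : ℤ) : Rˣ) : R) := by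
  have hA := Units.mul_inv (β.A x x)
  have hB := Units.mul_inv (β.B x x)
  have hw : (β.w : R) = -(β.A x x ^ 2 * (β.B x x)⁻¹ : Rˣ) := by simp [← β.kink x]
  have hc := β.circle x x
  rcases Int.units_eq_one_or ε with rfl | rfl
  · simp only [coeff, Units.val_one, zpow_one]
    rw [hw, ← hc]
    push_cast
    linear_combination -(β.B x x : R) * hA
  · simp only [coeff, Units.val_neg, Units.val_one, zpow_neg, zpow_one]
    refine (Units.mul_right_inj β.w).1 ?_
    rw [Units.mul_inv, hw, ← hc]
    push_cast
    linear_combination ((β.A x x : R) ^ 2 * ((β.B x x)⁻¹ : Rˣ) ^ 2 +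
      (β.A x x : R) * ((β.A x x)⁻¹ : Rˣ) + 1) * hA +
      ((β.A x x : R) * ((β.A x x)⁻¹ : Rˣ)) ^ 2 * hB

end BiquandleBracket

/-! ### Labels around crossings and triangles -/

namespace Biquandle

variable {X : Type*} [Biquandle X]

/-- The labels of the ends of a crossing with left labels `q.1` (under strand) and `q.2` (over
strand); `true` stands for the left and `false` for the right end. -/
def endLabel (q : X × X) : Strand → Bool → X
  | .lower, true => q.1
  | .lower, false => underBy q.1 q.2
  | .upper, true => q.2
  | .upper, false => overBy q.2 q.1

/-- The labels of two ends of different strands determine all labels at a crossing, and can be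
prescribed. -/
theorem bijective_endLabel (b b' : Bool) :
    Function.Bijective fun q : X × X => (endLabel q .lower b, endLabel q .upper b') := by
  cases b <;> cases b'
  · exact (Equiv.prodComm X X).bijective.comp bijective_sideways
  · constructor
    · rintro ⟨x, y⟩ ⟨x', y'⟩ h
      simp only [endLabel, Prod.mk.injEq] at h
      obtain ⟨h, rfl⟩ := h
      rw [(bijective_under y).1 h]
    · rintro ⟨x, y⟩
      obtain ⟨x', rfl⟩ := (bijective_under y).2 x
      exact ⟨(x', y), rfl⟩
  · constructor
    · rintro ⟨x, y⟩ ⟨x', y'⟩ h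
      simp only [endLabel, Prod.mk.injEq] at h
      obtain ⟨rfl, h⟩ := h
      rw [(bijective_over x).1 h]
    · rintro ⟨x, y⟩
      obtain ⟨y', rfl⟩ := (bijective_over x).2 y
      exact ⟨(x, y'), rfl⟩
  · exact Function.bijective_id

theorem injective_underBy_self : Function.Injective fun z : X => underBy z z := by
  intro z z' hz
  have h' : overBy z z = overBy z' z' := by rw [← under_self, ← under_self]; exact hz
  exact (Prod.ext_iff.1 (bijective_sideways.1 (Prod.ext h' hz : _ = _) : (z, z) = (z', z'))).1

theorem surjective_underBy_self [Finite X] : Function.Surjective fun z : X => underBy z z :=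
  Finite.injective_iff_surjective.1 injective_underBy_self

/-- The diagonal is the preimage of the diagonal under the sideways map, because that map is
injective and, `X` being finite, permutes the diagonal. -/
theorem eq_of_underBy_eq_overBy [Finite X] {x y : X} (h : underBy x y = overBy y x) : x = y := by
  obtain ⟨z, hz⟩ := surjective_underBy_self (underBy x y)
  have : (x, y) = (z, z) := bijective_sideways.1 <| by
    change (overBy y x, underBy x y) = (overBy z z, underBy z z)
    rw [← under_self, show underBy z z = underBy x y from hz, h]
  rw [Prod.mk.injEq] at this
  rw [this.1, this.2]

theorem endLabel_diag {q : X × X} (h : q.1 = q.2) (s s' : Strand) (b : Bool) :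
    endLabel q s b = endLabel q s' b := by
  obtain ⟨x, y⟩ := q
  obtain rfl : x = y := h
  cases s <;> cases s' <;> cases b <;> simp [endLabel, under_self]

/-- In a kink both outer ends have the label that the strand has without the kink. -/
theorem endLabel_eq_of_kink [Finite X] {q : X × X} {b : Bool}
    (h : endLabel q .lower b = endLabel q .upper b) : q.1 = q.2 := by
  cases b
  · exact eq_of_underBy_eq_overBy h
  · exact h

/-! Three strands, a bottom, a middle and a top one, have three crossings on either side of a
triangle move. If they all point down the page and all crossings are positive, let `x` and `z` be
the labels at the left ends of the bottom and the top strand, and `y` the label of the middle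
strand between its two crossings on that side of the move where it passes over the bottom strand
first. Then the left labels at the crossings are the following pairs, with `true` for this side and
`false` for the other. -/

/-- The left labels where the bottom strand passes under the middle one. -/
def pairU (p : Bool) (x y z : X) : X × X :=
  if p then (x, y) else (underBy x z, underBy y z)

/-- The left labels where the middle strand passes under the top one. -/
def pairV (p : Bool) (x y z : X) : X × X :=
  if p then (y, z) else (overBy y x, overBy z x)

/-- The left labels where the bottom strand passes under the top one. -/
def pairT (p : Bool) (x y z : X) : X × X :=
  if p then (underBy x y, overBy z y) else (x, z)

/-- Whatever the orientations of its sides, a labelled triangle has the labels of three of the six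
pairs, one of each kind. In each case the missing ones among `x`, `y`, `z` are found by inverting
the biquandle operations, and the exchange laws identify the remaining labels. -/
theorem exists_pairs_of_sides {pu pv pt : Bool} {qu qv qt : X × X}
    (hb : endLabel qu .lower (!pt) = endLabel qt .lower pu)
    (hm : endLabel qu .upper pv = endLabel qv .lower pu)
    (ht : endLabel qv .upper (!pt) = endLabel qt .upper pv) :
    ∃ x y z, qu = pairU pu x y z ∧ qv = pairV pv x y z ∧ qt = pairT pt x y z := by
  obtain ⟨a, b⟩ := qu
  obtain ⟨c, d⟩ := qv
  obtain ⟨e, f⟩ := qt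
  cases pu <;> cases pv <;> cases pt <;>
    simp only [endLabel, Bool.not_true, Bool.not_false] at hb hm ht
  · obtain ⟨y, rfl⟩ := (bijective_under f).2 b
    subst hb ht
    refine ⟨e, y, f, rfl, ?_, rfl⟩
    rw [exchange_under_over] at hm
    simp [pairV, (bijective_under _).1 hm]
  · obtain ⟨⟨x, z⟩, h⟩ := bijective_sideways.2 (d, a)
    simp only [Prod.mk.injEq] at h
    obtain ⟨rfl, rfl⟩ := h
    obtain ⟨y, rfl⟩ := (bijective_under z).2 b
    rw [exchange_under_over] at hm
    obtain rfl := (bijective_under _).1 hm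
    rw [exchange_over_over] at ht
    rw [exchange_under_under] at hb
    have := @(bijective_sideways (X := X)).1 (underBy x y, overBy z y) (e, f) (Prod.ext ht hb)
    exact ⟨x, y, z, rfl, rfl, this.symm⟩
  · subst hb hm ht
    exact ⟨e, c, d, rfl, rfl, rfl⟩
  · subst hm ht
    obtain ⟨x, rfl⟩ := (bijective_under c).2 e
    rw [← exchange_under_under] at hb
    refine ⟨x, c, d, ?_, rfl, rfl⟩
    simp [pairU, (bijective_under _).1 hb]
  · subst hb hm ht
    exact ⟨a, b, f, rfl, rfl, rfl⟩
  · subst hb hm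
    obtain ⟨z, rfl⟩ := (bijective_over a).2 d
    rw [exchange_over_over] at ht
    refine ⟨a, b, z, rfl, rfl, ?_⟩
    simp [pairT, (bijective_over _).1 ht]
  · subst hb hm ht
    exact ⟨a, b, d, rfl, rfl, rfl⟩
  · subst hb hm ht
    exact ⟨a, b, d, rfl, rfl, rfl⟩

section

variable (pu pv pt : Bool) (x y z : X)

theorem endLabel_bottom : endLabel (pairU pu x y z) .lower (!pt) =
    endLabel (pairT pt x y z) .lower pu := by
  cases pu <;> cases pt <;> simp [endLabel, pairU, pairT, exchange_under_under]

theorem endLabel_middle : endLabel (pairU pu x y z) .upper pv =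
    endLabel (pairV pv x y z) .lower pu := by
  cases pu <;> cases pv <;> simp [endLabel, pairU, pairV, exchange_under_over]

theorem endLabel_top : endLabel (pairV pv x y z) .upper (!pt) =
    endLabel (pairT pt x y z) .upper pv := by
  cases pv <;> cases pt <;> simp [endLabel, pairV, pairT, exchange_over_over]

end

end Biquandle

namespace BiquandleBracket

open Biquandle

variable {X : Type*} [Biquandle X] {R : Type*} [CommRing R] (β : BiquandleBracket X R)

/-- The sign `ε` if `p`, and `-ε` if not. -/
def signOf (ε : ℤˣ) (p : Bool) : ℤˣ := if p then ε else -ε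

/-- The coefficients, before and after a triangle move, of the crossings with signs `ε` and left
labels `q` and `q'`, where the ends `b` of the under and `b'` of the over strand
are the sides of the triangle. -/
def cornerCoeffs (ε : ℤˣ) (q q' : X × X) (b b' : Bool) : CornerCoeffs R where
  κ := β.coeff ε q (.joining b b')
  π := β.coeff ε q (.joining b !b')
  κ' := β.coeff ε q' (.joining b b')
  π' := β.coeff ε q' (.joining b !b')

/-- For three positive crossings the equations are the axioms of a bracket. -/
theorem hexagon_basic (x y z : X) : Hexagon β.δ
    (β.cornerCoeffs 1 (pairU true x y z) (pairU false x y z) false true)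
    (β.cornerCoeffs 1 (pairV true x y z) (pairV false x y z) true false)
    (β.cornerCoeffs 1 (pairT true x y z) (pairT false x y z) true true) := by
  have hc := β.circle_mul
  have h1 := β.AAA x y z
  have h2 := β.ABB x y z
  have h3 := β.BAB x y z
  have h4 := β.AAB x y z
  have h5 := β.BAA x y z
  constructor <;>
    simp only [cornerCoeffs, coeff, Smoothing.joining, pairU, pairV, pairT, Units.val_one, zpow_one,
      Bool.not_true, Bool.not_false, if_true, if_false, reduceCtorEq]
  · exact Hexagon.circle_swap (hc (x, y))
  · exact Hexagon.circle_swap (hc (underBy x z, underBy y z))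
  · exact Hexagon.circle_swap (hc (y, z))
  · exact Hexagon.circle_swap (hc (overBy y x, overBy z x))
  · exact hc (underBy x y, overBy z y)
  · exact hc (x, z)
  · linear_combination h3
  · linear_combination h2
  · linear_combination h1
  · linear_combination h4
  · linear_combination -h5

theorem hexagon_one (pu pv pt : Bool) (x y z : X) : Hexagon β.δ
    (β.cornerCoeffs (signOf 1 pu) (pairU pu x y z) (pairU (!pu) x y z) (!pt) pv)
    (β.cornerCoeffs (signOf 1 pv) (pairV pv x y z) (pairV (!pv) x y z) pu (!pt))
    (β.cornerCoeffs (signOf 1 pt) (pairT pt x y z) (pairT (!pt) x y z) pu pv) := by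
  have h := β.hexagon_basic x y z
  have flip_b : ∀ {δ : R} {a b c}, Hexagon δ a b c → Hexagon δ a.swap b.flip c.swap :=
    fun h => h.rotate.flip.rotate.rotate
  have flip_c : ∀ {δ : R} {a b c}, Hexagon δ a b c → Hexagon δ a.swap b.swap c.flip :=
    fun h => h.rotate.rotate.flip.rotate
  cases pu <;> cases pv <;> cases pt
  · have := flip_c (flip_b h.flip)
    simpa [cornerCoeffs, signOf, coeff, Smoothing.joining, CornerCoeffs.flip, CornerCoeffs.swap]
  · have := flip_b h.flip
    simpa [cornerCoeffs, signOf, coeff, Smoothing.joining, CornerCoeffs.flip, CornerCoeffs.swap]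
  · have := flip_c h.flip
    simpa [cornerCoeffs, signOf, coeff, Smoothing.joining, CornerCoeffs.flip, CornerCoeffs.swap]
  · have := h.flip
    simpa [cornerCoeffs, signOf, coeff, Smoothing.joining, CornerCoeffs.flip, CornerCoeffs.swap]
  · have := flip_c (flip_b h)
    simpa [cornerCoeffs, signOf, coeff, Smoothing.joining, CornerCoeffs.flip, CornerCoeffs.swap]
  · have := flip_b h
    simpa [cornerCoeffs, signOf, coeff, Smoothing.joining, CornerCoeffs.flip, CornerCoeffs.swap]
  · have := flip_c h
    simpa [cornerCoeffs, signOf, coeff, Smoothing.joining, CornerCoeffs.flip, CornerCoeffs.swap]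
  · have := h
    simpa [cornerCoeffs, signOf, coeff, Smoothing.joining, CornerCoeffs.flip, CornerCoeffs.swap]

theorem hexagon (ε : ℤˣ) (pu pv pt : Bool) (x y z : X) : Hexagon β.δ
    (β.cornerCoeffs (signOf ε pu) (pairU pu x y z) (pairU (!pu) x y z) (!pt) pv)
    (β.cornerCoeffs (signOf ε pv) (pairV pv x y z) (pairV (!pv) x y z) pu (!pt))
    (β.cornerCoeffs (signOf ε pt) (pairT pt x y z) (pairT (!pt) x y z) pu pv) := by
  rcases Int.units_eq_one_or ε with rfl | rfl
  · exact β.hexagon_one pu pv pt x y z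
  · have h := (β.hexagon_one (!pu) (!pv) (!pt) x y z).symm
    have hs : ∀ p, signOf 1 (!p) = signOf (-1) p := by decide
    have hj : ∀ b b', Smoothing.joining (!b) b' = .joining b !b' := by decide
    simpa only [CornerCoeffs.symm, cornerCoeffs, hs, hj, Bool.not_not] using h

end BiquandleBracket

/-! ### State sums under local moves -/

section LocalMoves

open Setoid

variable {C α R : Type*}

/-- No three different ends of crossings belong to the same semiarc. -/
def AtMostTwoEnds (e : C → Strand → Bool → α) : Prop :=
  ∀ c s b c' s' b' c'' s'' b'', e c s b = e c' s' b' → e c s b = e c'' s'' b'' →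
    (c = c' ∧ s = s' ∧ b = b') ∨ (c = c'' ∧ s = s'' ∧ b = b'') ∨ (c' = c'' ∧ s' = s'' ∧ b' = b'')

/-- If two ends belong to the same semiarc, then no third end does. -/
theorem AtMostTwoEnds.ne {e : C → Strand → Bool → α} (h : AtMostTwoEnds e) {c s b c' s' b'}
    {a : α} (h1 : e c s b = a) (h2 : e c' s' b' = a) (h12 : ¬(c = c' ∧ s = s' ∧ b = b'))
    {c'' s'' b''} (h13 : ¬(c = c'' ∧ s = s'' ∧ b = b'')) (h23 : ¬(c' = c'' ∧ s' = s'' ∧ b' = b'')) :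
    e c'' s'' b'' ≠ a := by
  intro h3
  rcases h c s b c' s' b' c'' s'' b'' (h1.trans h2.symm) (h1.trans h3.symm) with h | h | h
  · exact h12 h
  · exact h13 h
  · exact h23 h

/-- The crossings `u` (of the bottom with the middle strand), `v` (of the middle with the top
strand) and `t` (of the bottom with the top strand) form a triangle with sides `i` (bottom), `j`
(middle) and `k` (top). The parameters `pu`, `pv`, `pt` tell which ends of the crossings the sides
are. -/
structure TriangleSides (e : C → Strand → Bool → α) (u v t : C) (pu pv pt : Bool)
    (i j k : α) : Prop where
  bottom_u : e u .lower (!pt) = i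
  bottom_t : e t .lower pu = i
  middle_u : e u .upper pv = j
  middle_v : e v .lower pu = j
  top_v : e v .upper (!pt) = k
  top_t : e t .upper pv = k

/-- The ends `e'` arise from `e` by a triangle move: on each strand the two outer ends trade
crossings. -/
structure TriangleSwap (e e' : C → Strand → Bool → α) (u v t : C) (pu pv pt : Bool) :
    Prop where
  bottom_u : e' u .lower (!pt) = e t .lower (!pu)
  bottom_t : e' t .lower pu = e u .lower pt
  middle_u : e' u .upper pv = e v .lower (!pu)
  middle_v : e' v .lower pu = e u .upper (!pv)
  top_v : e' v .upper (!pt) = e t .upper (!pv)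
  top_t : e' t .upper pv = e v .upper pt
  away : ∀ c, c ≠ u → c ≠ v → c ≠ t → e' c = e c

section

variable {e e' : C → Strand → Bool → α} {u v t : C} {pu pv pt : Bool} {i j k : α}

theorem TriangleSwap.symm (h : TriangleSwap e e' u v t pu pv pt) :
    TriangleSwap e' e u v t (!pu) (!pv) (!pt) where
  bottom_u := by simpa using h.bottom_t.symm
  bottom_t := by simpa using h.bottom_u.symm
  middle_u := by simpa using h.middle_v.symm
  middle_v := by simpa using h.middle_u.symm
  top_v := by simpa using h.top_t.symm
  top_t := by simpa using h.top_v.symm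
  away c h1 h2 h3 := (h.away c h1 h2 h3).symm

/-- The sides of a triangle are different from the semiarcs at the outer ends of its crossings, and
from those at all other crossings. -/
theorem TriangleSides.outer_ne (he : AtMostTwoEnds e) (huv : u ≠ v) (hvt : v ≠ t) (hut : u ≠ t)
    (h : TriangleSides e u v t pu pv pt i j k) :
    (∀ a ∈ ({e u .lower pt, e u .upper !pv, e v .lower !pu, e v .upper pt, e t .lower !pu,
      e t .upper !pv} : Set α), a ≠ i ∧ a ≠ j ∧ a ≠ k) ∧
    ∀ c, c ≠ u → c ≠ v → c ≠ t → ∀ s b, e c s b ≠ i ∧ e c s b ≠ j ∧ e c s b ≠ k := by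
  have ne_i := @AtMostTwoEnds.ne _ _ _ he u .lower (!pt) t .lower pu i h.bottom_u h.bottom_t
    (by simp [hut])
  have ne_j := @AtMostTwoEnds.ne _ _ _ he u .upper pv v .lower pu j h.middle_u h.middle_v
    (by simp [huv])
  have ne_k := @AtMostTwoEnds.ne _ _ _ he v .upper (!pt) t .upper pv k h.top_v h.top_t
    (by simp [hvt])
  constructor
  · simp only [Set.mem_insert_iff, Set.mem_singleton_iff, forall_eq_or_imp, forall_eq]
    refine ⟨⟨ne_i ?_ ?_, ne_j ?_ ?_, ne_k ?_ ?_⟩, ⟨ne_i ?_ ?_, ne_j ?_ ?_, ne_k ?_ ?_⟩,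
      ⟨ne_i ?_ ?_, ne_j ?_ ?_, ne_k ?_ ?_⟩, ⟨ne_i ?_ ?_, ne_j ?_ ?_, ne_k ?_ ?_⟩,
      ⟨ne_i ?_ ?_, ne_j ?_ ?_, ne_k ?_ ?_⟩, ⟨ne_i ?_ ?_, ne_j ?_ ?_, ne_k ?_ ?_⟩⟩ <;>
    simp [huv, hvt, hut, huv.symm, hvt.symm, hut.symm]
  · intro c h1 h2 h3 s b
    refine ⟨ne_i ?_ ?_, ne_j ?_ ?_, ne_k ?_ ?_⟩ <;> simp [h1.symm, h2.symm, h3.symm]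

theorem TriangleSides.sides_ne (he : AtMostTwoEnds e) (huv : u ≠ v) (hvt : v ≠ t) (hut : u ≠ t)
    (h : TriangleSides e u v t pu pv pt i j k) : i ≠ j ∧ i ≠ k ∧ j ≠ k := by
  have ne_j := @AtMostTwoEnds.ne _ _ _ he u .upper pv v .lower pu j h.middle_u h.middle_v
    (by simp [huv])
  have ne_k := @AtMostTwoEnds.ne _ _ _ he v .upper (!pt) t .upper pv k h.top_v h.top_t
    (by simp [hvt])
  exact ⟨h.bottom_u ▸ ne_j (by simp) (by simp [huv.symm]), h.bottom_u ▸ ne_k (by simp) (by simp),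
    h.middle_u ▸ ne_k (by simp [huv.symm]) (by simp [hut.symm])⟩

end

variable [Fintype C] [DecidableEq C] [Finite α] [CommRing R]

/-- Removing a kink divides the state sum by the contribution of the kink. -/
theorem stateSum_eq_of_kink {e : C → Strand → Bool → α} (he : AtMostTwoEnds e)
    (f : C → Smoothing → R) (δ : R) {c : C} {b : Bool} (hc : e c .lower b = e c .upper b) :
    stateSum e f δ = (δ * f c .oriented + f c .disoriented) *
      outerSum e f {c} fun E => δ ^ (E ⊔ ⨆ d ∈ ({c} : Finset C), through (e d)).classCount := by
  rw [stateSum_eq_outerSum, outerSum_eq_outerSum_insert e f (Finset.notMem_empty c),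
    ← outerSum_const_mul]
  refine outerSum_congr (fun _ _ => rfl) (fun _ _ => rfl) fun E hE => ?_
  have ne := @AtMostTwoEnds.ne _ _ _ he c .lower b c .upper b _ rfl hc.symm (by simp)
  rw [Finset.iSup_singleton]
  refine sum_smoothing_kink (hE _ fun d hd s b => ?_) rfl hc.symm ?_ ?_ _ _
  · have : d ≠ c := by simpa using hd
    exact ne (by simp [this.symm]) (by simp [this.symm])
  · exact ne (by simp) (by simp)
  · exact ne (by simp) (by simp)

theorem stateSum_eq_of_bigon {e : C → Strand → Bool → α} (he : AtMostTwoEnds e)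
    {f : C → Smoothing → R} {δ : R} {c d : C} (hcd : c ≠ d) {b b' : Bool}
    (hl : e c .lower b = e d .lower b) (hu : e c .upper b' = e d .upper b')
    (hf : ∀ x, f c x * f d x = 1)
    (hδ : f c .oriented * f d .disoriented + f c .disoriented * f d .oriented = -δ) :
    stateSum e f δ =
      outerSum e f {c, d} fun E => δ ^ (E ⊔ ⨆ x ∈ ({c, d} : Finset C), through (e x)).classCount := by
  rw [stateSum_eq_outerSum, outerSum_eq_outerSum_insert e f (Finset.notMem_empty d),
    outerSum_eq_outerSum_insert e f (c := c) (by simpa using hcd)]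
  refine outerSum_congr (fun _ _ => rfl) (fun _ _ => rfl) fun E hE => ?_
  have nel := @AtMostTwoEnds.ne _ _ _ he c .lower b d .lower b _ rfl hl.symm (by simp [hcd])
  have neu := @AtMostTwoEnds.ne _ _ _ he c .upper b' d .upper b' _ rfl hu.symm (by simp [hcd])
  have key := sum_smoothing_bigon (E := E) (e := e c) (e' := e d) (f := f c) (g := f d) (δ := δ)
    (hE (e c .lower b) fun c' hc' s x => ?_) (hE (e c .upper b') fun c' hc' s x => ?_)
    (neu (by simp) (by simp)) rfl rfl hl.symm hu.symm
    (nel (by simp) (by simp)) (neu (by simp) (by simp)) (nel (by simp) (by simp))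
    (neu (by simp) (by simp)) (nel (by simp) (by simp)) (neu (by simp) (by simp))
    (nel (by simp) (by simp)) (neu (by simp) (by simp)) hf hδ
  · have h : (⨆ x ∈ ({c, d} : Finset C), through (e x)) = through (e c) ⊔ through (e d) := by
      rw [Finset.iSup_insert, Finset.iSup_singleton]
    rw [h, ← sup_assoc, ← key]
    refine Finset.sum_congr rfl fun x _ => ?_
    rw [Finset.mul_sum]
    refine Finset.sum_congr rfl fun y _ => ?_
    ring
  all_goals
    have hc' : c' ≠ c ∧ c' ≠ d := by simpa using hc'
  · exact nel (by simp [hc'.1.symm]) (by simp [hc'.2.symm])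
  · exact neu (by simp [hc'.1.symm]) (by simp [hc'.2.symm])

/-- A triangle move preserves the state sum if the coefficients satisfy the equations `Hexagon`. The
triangle after the move has the opposite parameters, and hence the same corner smoothings. -/
theorem stateSum_eq_of_triangle {e e' : C → Strand → Bool → α} (he : AtMostTwoEnds e)
    {f f' : C → Smoothing → R} {δ : R} {u v t : C} (huv : u ≠ v) (hvt : v ≠ t) (hut : u ≠ t)
    {pu pv pt : Bool} {i j k : α} (h : TriangleSides e u v t pu pv pt i j k)
    (h' : TriangleSides e' u v t (!pu) (!pv) (!pt) i j k)
    (hs : TriangleSwap e e' u v t pu pv pt)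
    (hf : ∀ c, c ≠ u → c ≠ v → c ≠ t → f c = f' c)
    {a b c : CornerCoeffs R} (hex : Hexagon δ a b c)
    (hau : f u (.joining (!pt) pv) = a.κ ∧ f u (.joining (!pt) !pv) = a.π ∧
      f' u (.joining (!pt) pv) = a.κ' ∧ f' u (.joining (!pt) !pv) = a.π')
    (hbv : f v (.joining pu !pt) = b.κ ∧ f v (.joining pu !!pt) = b.π ∧
      f' v (.joining pu !pt) = b.κ' ∧ f' v (.joining pu !!pt) = b.π')
    (hct : f t (.joining pu pv) = c.κ ∧ f t (.joining pu !pv) = c.π ∧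
      f' t (.joining pu pv) = c.κ' ∧ f' t (.joining pu !pv) = c.π') :
    stateSum e f δ = stateSum e' f' δ := by
  have hT : ∀ {d : C}, d ∉ ({u, v, t} : Finset C) → d ≠ u ∧ d ≠ v ∧ d ≠ t := by
    intro d hd
    simpa using hd
  have expand : ∀ (e : C → Strand → Bool → α) (f : C → Smoothing → R), stateSum e f δ =
      outerSum e f {u, v, t} fun E => ∑ x, ∑ y, ∑ z, f u x * f v y * f t z *
        δ ^ (E ⊔ node (e u) x ⊔ node (e v) y ⊔ node (e t) z).classCount := by
    intro e f
    rw [stateSum_eq_outerSum, outerSum_eq_outerSum_insert e f (Finset.notMem_empty t),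
      outerSum_eq_outerSum_insert e f (c := v) (by simpa using hvt),
      outerSum_eq_outerSum_insert e f (c := u) (by simp [huv, hut])]
    simp only [Finset.mul_sum, mul_assoc]
    rfl
  rw [expand, expand]
  refine outerSum_congr (fun d hd => (hs.away d (hT hd).1 (hT hd).2.1 (hT hd).2.2).symm)
    (fun d hd => hf d (hT hd).1 (hT hd).2.1 (hT hd).2.2) fun E hE => ?_
  obtain ⟨hij, hik, hjk⟩ := h.sides_ne he huv hvt hut
  obtain ⟨hout, haway⟩ := h.outer_ne he huv hvt hut
  simp only [Set.mem_insert_iff, Set.mem_singleton_iff, forall_eq_or_imp, forall_eq] at hout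
  obtain ⟨hbu, hmu, hmv, htv, hbt, htt⟩ := hout
  have haway' := fun d hd => haway d (hT hd).1 (hT hd).2.1 (hT hd).2.2
  have hi : E.IsolatedAt i := hE i fun d hd s x => (haway' d hd s x).1
  have hj : E.IsolatedAt j := hE j fun d hd s x => (haway' d hd s x).2.1
  have hk : E.IsolatedAt k := hE k fun d hd s x => (haway' d hd s x).2.2
  have hju : ∀ b b', Smoothing.joining (!b) b' = .joining b !b' := by decide
  rw [sum_smoothing_triangle (δ := δ) hi hj hk hij hik hjk hbu hmu hmv htv hbt htt
      (eu := e u) (ev := e v) (et := e t)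
      ⟨h.bottom_u, h.middle_u, by rw [Bool.not_not], rfl⟩
      ⟨h.middle_v, h.top_v, rfl, by rw [Bool.not_not]⟩
      ⟨h.bottom_t, h.top_t, rfl, rfl⟩ hau.1 hau.2.1 hbv.1 hbv.2.1 hct.1 hct.2.1,
    sum_smoothing_triangle (δ := δ) hi hj hk hij hik hjk hbt hmv hmu htt hbu htv
      (eu := e' u) (ev := e' v) (et := e' t) (xu := pt) (yu := !pv) (xv := !pu) (yv := pt)
      (xt := !pu) (yt := !pv)
      ⟨by simpa using h'.bottom_u, h'.middle_u, hs.bottom_u, by simpa using hs.middle_u⟩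
      ⟨h'.middle_v, by simpa using h'.top_v, by simpa using hs.middle_v, hs.top_v⟩
      ⟨h'.bottom_t, h'.top_t, by simpa using hs.bottom_t, by simpa using hs.top_t⟩
      (by rw [← hju, hau.2.2.1]) (by rw [← hju, hau.2.2.2])
      (by rw [hju, hbv.2.2.1]) (by rw [hju, hbv.2.2.2])
      (by rw [Smoothing.joining_not_not, hct.2.2.1])
      (by rw [Smoothing.joining_not_not, hct.2.2.2])]
  -- the six outer ends are joined by the same five matchings on both sides
  rw [hex.corner_a, hex.corner_b, hex.corner_c, hex.pass, ← hex.pass']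
  generalize e u .lower pt = bu, e u .upper (!pv) = mu, e v .lower (!pu) = mv, e v .upper pt = tv,
    e t .lower (!pu) = bt, e t .upper (!pv) = tt
  have m₁ : E ⊔ link bt mv ⊔ link mu tt ⊔ link bu tv = E ⊔ link mu tt ⊔ link bu tv ⊔ link mv bt :=
    eq_of_forall_ge_iff fun S => by
      simp only [sup_le_iff, link_le_iff]
      grind
  have m₂ : E ⊔ link mv tv ⊔ link bt tt ⊔ link mu bu = E ⊔ link bu mu ⊔ link mv tv ⊔ link bt tt :=
    eq_of_forall_ge_iff fun S => by
      simp only [sup_le_iff, link_le_iff]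
      grind
  have m₃ : E ⊔ link bt mv ⊔ link tt tv ⊔ link mu bu = E ⊔ link bu mu ⊔ link tv tt ⊔ link mv bt :=
    eq_of_forall_ge_iff fun S => by
      simp only [sup_le_iff, link_le_iff]
      grind
  have m₄ : E ⊔ link mv tv ⊔ link mu tt ⊔ link bt bu = E ⊔ link mu tt ⊔ link mv tv ⊔ link bu bt :=
    eq_of_forall_ge_iff fun S => by
      simp only [sup_le_iff, link_le_iff]
      grind
  have m₅ : E ⊔ link mv mu ⊔ link bt tt ⊔ link bu tv = E ⊔ link mu mv ⊔ link bu tv ⊔ link bt tt :=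
    eq_of_forall_ge_iff fun S => by
      simp only [sup_le_iff, link_le_iff]
      grind
  rw [m₁, m₂, m₃, m₄, m₅]
  ring

end LocalMoves

/-! ### Diagrams in terms of the ends of their crossings -/

namespace Diagram

open Setoid Biquandle

variable (D : Diagram)

/-- The semiarc at the left (`true`) or right (`false`) end of a strand at a crossing that is drawn
with both strands pointing down. -/
def endArc (c : D.Crossing) : Strand → Bool → D.Arc
  | .lower, true => D.underLeft c
  | .lower, false => D.underRight c
  | .upper, true => D.overLeft c
  | .upper, false => D.overRight c

/-- Whether the strand enters the crossing at the given end. -/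
def isInn (c : D.Crossing) : Strand → Bool → Bool
  | .lower, b => b == decide (D.sign c = 1)
  | .upper, b => b != decide (D.sign c = 1)

theorem endArc_eq (c : D.Crossing) (s : Strand) (b : Bool) :
    D.endArc c s b = if D.isInn c s b then D.inn c s else D.out c s := by
  cases s <;> cases b <;> by_cases h : D.sign c = 1 <;>
    simp [endArc, isInn, underLeft, underRight, overLeft, overRight, h]

variable {D}

theorem eq_of_endArc_eq {c c' : D.Crossing} {s s' : Strand} {b b' : Bool}
    (h : D.endArc c s b = D.endArc c' s' b') (hi : D.isInn c s b = D.isInn c' s' b') :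
    c = c' ∧ s = s' ∧ b = b' := by
  have hcs : (c, s) = (c', s') := by
    rw [endArc_eq, endArc_eq, ← hi] at h
    split at h
    · exact D.inn_injective h
    · exact D.out_injective h
  obtain ⟨rfl, rfl⟩ := Prod.mk.inj hcs
  refine ⟨rfl, rfl, ?_⟩
  cases s <;> cases b <;> cases b' <;> simp_all [isInn]

variable (D)

/-- A semiarc begins at most once and ends at most once. -/
theorem atMostTwoEnds_endArc : AtMostTwoEnds D.endArc := by
  intro c s b c' s' b' c'' s'' b'' h h'
  -- two of the three ends are both incoming or both outgoing
  by_cases h1 : D.isInn c s b = D.isInn c' s' b'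
  · exact .inl (eq_of_endArc_eq h h1)
  · by_cases h2 : D.isInn c s b = D.isInn c'' s'' b''
    · exact .inr (.inl (eq_of_endArc_eq h' h2))
    · refine .inr (.inr (eq_of_endArc_eq (h.symm.trans h') ?_))
      revert h1 h2
      cases D.isInn c s b <;> cases D.isInn c' s' b' <;> cases D.isInn c'' s'' b'' <;> simp

theorem sign_eq_one_or (c : D.Crossing) : D.sign c = 1 ∨ D.sign c = -1 :=
  Int.units_eq_one_or _

theorem neg_one_ne_one : (-1 : ℤˣ) ≠ 1 := by decide

/-- In terms of ends, smoothings make the same connections at positive and negative crossings. -/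
theorem loopCount_eq (s : D.Crossing → Smoothing) :
    D.loopCount s = (⨆ c, node (D.endArc c) (s c)).classCount := by
  have h : (⨆ c, node (D.endArc c) (s c)) = Relation.EqvGen.setoid (D.Joined s) := by
    apply le_antisymm
    · refine iSup_le fun c => ?_
      have ho : s c = .oriented → ∀ r, Relation.EqvGen.setoid (D.Joined s)
          (D.inn c r) (D.out c r.other) := fun h r => .rel _ _ (.oriented c h r)
      have hi : s c = .disoriented → Relation.EqvGen.setoid (D.Joined s)
          (D.inn c .upper) (D.inn c .lower) := fun h => .rel _ _ (.disoriented_inn c h)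
      have hu : s c = .disoriented → Relation.EqvGen.setoid (D.Joined s)
          (D.out c .upper) (D.out c .lower) := fun h => .rel _ _ (.disoriented_out c h)
      cases hs : s c
      · have h1 := ho hs .lower
        have h2 := ho hs .upper
        simp only [node, sup_le_iff, link_le_iff_rel]
        rcases D.sign_eq_one_or c with hc | hc <;>
          simp only [endArc, underLeft, underRight, overLeft, overRight, hc, neg_one_ne_one, if_true,
            if_false]
        · exact ⟨h1, Setoid.symm' _ h2⟩
        · exact ⟨Setoid.symm' _ h2, h1⟩
      · have h1 := hi hs
        have h2 := hu hs
        simp only [node, sup_le_iff, link_le_iff_rel]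
        rcases D.sign_eq_one_or c with hc | hc <;>
          simp only [endArc, underLeft, underRight, overLeft, overRight, hc, neg_one_ne_one, if_true,
            if_false]
        · exact ⟨Setoid.symm' _ h1, Setoid.symm' _ h2⟩
        · exact ⟨Setoid.symm' _ h2, Setoid.symm' _ h1⟩
    · refine Setoid.eqvGen_le fun x y hxy => ?_
      have hle : ∀ c, node (D.endArc c) (s c) ≤ ⨆ c, node (D.endArc c) (s c) :=
        fun c => le_iSup (fun c => node (D.endArc c) (s c)) c
      cases hxy with
      | oriented c hs r =>
        have := hle c
        rw [hs] at this
        simp only [node, sup_le_iff, link_le_iff_rel] at this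
        rcases D.sign_eq_one_or c with hc | hc <;>
          simp only [endArc, underLeft, underRight, overLeft, overRight, hc, neg_one_ne_one, if_true,
            if_false] at this <;> cases r
        · exact Setoid.symm' _ this.2
        · exact this.1
        · exact Setoid.symm' _ this.1
        · exact this.2
      | disoriented_inn c hs =>
        have := hle c
        rw [hs] at this
        simp only [node, sup_le_iff, link_le_iff_rel] at this
        rcases D.sign_eq_one_or c with hc | hc <;>
          simp only [endArc, underLeft, underRight, overLeft, overRight, hc, neg_one_ne_one, if_true,
            if_false] at this
        · exact Setoid.symm' _ this.1
        · exact Setoid.symm' _ this.2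
      | disoriented_out c hs =>
        have := hle c
        rw [hs] at this
        simp only [node, sup_le_iff, link_le_iff_rel] at this
        rcases D.sign_eq_one_or c with hc | hc <;>
          simp only [endArc, underLeft, underRight, overLeft, overRight, hc, neg_one_ne_one, if_true,
            if_false] at this
        · exact Setoid.symm' _ this.2
        · exact Setoid.symm' _ this.1
  rw [h]
  exact Nat.card_congr
    { toFun := Quot.map id fun _ _ h => Relation.EqvGen.rel _ _ h
      invFun := Quotient.lift (Quot.mk _) fun _ _ h => Quot.eqvGen_sound h
      left_inv := fun q => by induction q using Quot.ind; rfl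
      right_inv := fun q => by induction q using Quotient.ind; rfl }

namespace Coloring

variable {D} {X : Type*} [Biquandle X]

/-- The labels of the left semiarcs of the under and the over strand. -/
def leftLabels (f : D.Coloring X) (c : D.Crossing) : X × X :=
  (f.color (D.underLeft c), f.color (D.overLeft c))

theorem color_endArc (f : D.Coloring X) (c : D.Crossing) (s : Strand) (b : Bool) :
    f.color (D.endArc c s b) = endLabel (f.leftLabels c) s b := by
  cases s <;> cases b
  · exact f.over_rel c
  · rfl
  · exact f.under_rel c
  · rfl

theorem leftLabels_eq (f : D.Coloring X) {c : D.Crossing} {q : X × X} {b b' : Bool}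
    (h : f.color (D.endArc c .lower b) = endLabel q .lower b)
    (h' : f.color (D.endArc c .upper b') = endLabel q .upper b') : f.leftLabels c = q := by
  rw [color_endArc] at h h'
  exact (bijective_endLabel b b').1 (Prod.ext h h')

/-- A labelling is a coloring if the labels around every crossing are those of some pair. -/
def ofEndLabels (col : D.Arc → X)
    (h : ∀ c, ∃ q, ∀ s b, col (D.endArc c s b) = endLabel q s b) : D.Coloring X where
  color := col
  under_rel c := by
    obtain ⟨q, hq⟩ := h c
    have h1 : col (D.underRight c) = _ := hq .lower false
    have h2 : col (D.underLeft c) = _ := hq .lower true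
    have h3 : col (D.overLeft c) = _ := hq .upper true
    rw [h1, h2, h3]
    rfl
  over_rel c := by
    obtain ⟨q, hq⟩ := h c
    have h1 : col (D.overRight c) = _ := hq .upper false
    have h2 : col (D.underLeft c) = _ := hq .lower true
    have h3 : col (D.overLeft c) = _ := hq .upper true
    rw [h1, h2, h3]
    rfl

/-- The skein coefficients of a colored diagram. -/
noncomputable def coeffs {R : Type*} [CommRing R] (β : BiquandleBracket X R) (f : D.Coloring X)
    (c : D.Crossing) (x : Smoothing) : R :=
  β.coeff (D.sign c) (f.leftLabels c) x

theorem bracketValue_eq {R : Type*} [CommRing R] (β : BiquandleBracket X R) (f : D.Coloring X) :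
    bracketValue β f =
      ((β.w ^ (-D.writhe) : Rˣ) : R) * stateSum D.endArc (f.coeffs β) β.δ := by
  have h : ∀ c x, (skeinCoeff β f c x : R) = f.coeffs β c x := by
    intro c x
    cases x <;> rfl
  simp only [bracketValue, stateSum, loopCount_eq, h]

end Coloring

/-! ### Comparing the colorings of two diagrams -/

variable {D} {D' : Diagram} {X : Type*} [Biquandle X] {R : Type*} [CommRing R]

/-- Colorings are determined by the labels of the semiarcs in `Ext` if every other semiarc is
an end of a crossing at which both strands have an end in `Ext`. -/
theorem Coloring.eq_of_eqOn {f g : D.Coloring X} {Ext : Set D.Arc}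
    (hfg : ∀ a ∈ Ext, f.color a = g.color a)
    (hdet : ∀ a ∉ Ext, ∃ c s₀ b₀ b b', a = D.endArc c s₀ b₀ ∧ D.endArc c .lower b ∈ Ext ∧
      D.endArc c .upper b' ∈ Ext) : f = g := by
  ext a
  by_cases ha : a ∈ Ext
  · exact hfg a ha
  · obtain ⟨c, s₀, b₀, b, b', rfl, hb, hb'⟩ := hdet a ha
    have : f.leftLabels c = g.leftLabels c := f.leftLabels_eq
      ((hfg _ hb).trans (g.color_endArc c _ b)) ((hfg _ hb').trans (g.color_endArc c _ b'))
    rw [f.color_endArc, g.color_endArc, this]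

/-- Two diagrams have corresponding colorings: the correspondence is compatible with endomorphisms
of the biquandle and preserves bracket values. -/
def ColoringsCorrespond (β : BiquandleBracket X R) (D D' : Diagram) : Prop :=
  ∃ F : D.Coloring X ≃ D'.Coloring X,
    (∀ (φ : BiquandleHom X X) f, F (f.map φ) = (F f).map φ) ∧
      ∀ f, bracketValue β (F f) = bracketValue β f

namespace ColoringsCorrespond

variable {β : BiquandleBracket X R} {D'' : Diagram}

theorem refl (D : Diagram) : ColoringsCorrespond β D D :=
  ⟨Equiv.refl _, fun _ _ => rfl, fun _ => rfl⟩

theorem symm (h : ColoringsCorrespond β D D') : ColoringsCorrespond β D' D := by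
  obtain ⟨F, hF, hβ⟩ := h
  refine ⟨F.symm, fun φ f => ?_, fun f => ?_⟩
  · rw [Equiv.symm_apply_eq, hF, Equiv.apply_symm_apply]
  · rw [← hβ, Equiv.apply_symm_apply]

theorem trans (h : ColoringsCorrespond β D D') (h' : ColoringsCorrespond β D' D'') :
    ColoringsCorrespond β D D'' := by
  obtain ⟨F, hF, hβ⟩ := h
  obtain ⟨F', hF', hβ'⟩ := h'
  exact ⟨F.trans F', fun φ f => by simp [hF, hF'], fun f => by simp [hβ, hβ']⟩

theorem nonempty_iso (h : ColoringsCorrespond β D D') (S : Set (BiquandleHom X X)) :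
    Nonempty ((D.bracketQuiver β S).Iso (D'.bracketQuiver β S)) := by
  obtain ⟨F, hF, hβ⟩ := h
  have hedge : ∀ (f g : D.Coloring X) (φ : BiquandleHom X X),
      φ ∈ S ∧ f.map φ = g ↔ φ ∈ S ∧ (F f).map φ = F g := fun f g φ => by
    rw [← hF, F.apply_eq_iff_eq]
  exact ⟨{
    vertex := F
    edge := fun f g => Equiv.subtypeEquivRight (hedge f g)
    weight_eq := hβ }⟩

/-- Colorings correspond if they determine each other by agreeing on the semiarcs of `Ext` that a
move leaves in place. -/
theorem of_agree (arc : D.Arc → D'.Arc) (Ext : Set D.Arc)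
    (hdet' : ∀ a' ∉ arc '' Ext, ∃ c s₀ b₀ b b', a' = D'.endArc c s₀ b₀ ∧
      D'.endArc c .lower b ∈ arc '' Ext ∧ D'.endArc c .upper b' ∈ arc '' Ext)
    (hto : ∀ f : D.Coloring X, ∃ f' : D'.Coloring X, ∀ a ∈ Ext, f'.color (arc a) = f.color a)
    (hback : ∀ f' : D'.Coloring X, ∃ f : D.Coloring X, ∀ a ∈ Ext, f'.color (arc a) = f.color a)
    (hdet : ∀ a ∉ Ext, ∃ c s₀ b₀ b b', a = D.endArc c s₀ b₀ ∧ D.endArc c .lower b ∈ Ext ∧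
      D.endArc c .upper b' ∈ Ext)
    (hval : ∀ (f : D.Coloring X) (f' : D'.Coloring X),
      (∀ a ∈ Ext, f'.color (arc a) = f.color a) → bracketValue β f' = bracketValue β f) :
    ColoringsCorrespond β D D' := by
  have unique : ∀ {f' g' : D'.Coloring X} {f : D.Coloring X},
      (∀ a ∈ Ext, f'.color (arc a) = f.color a) → (∀ a ∈ Ext, g'.color (arc a) = f.color a) →
      f' = g' := by
    intro f' g' f hf hg
    refine Coloring.eq_of_eqOn ?_ hdet'
    rintro _ ⟨a, ha, rfl⟩
    rw [hf a ha, hg a ha]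
  choose F hF using hto
  refine ⟨Equiv.ofBijective F ⟨fun f g h => ?_, fun f' => ?_⟩, fun φ f => ?_, fun f => ?_⟩
  · exact Coloring.eq_of_eqOn (fun a ha => by rw [← hF f a ha, h, hF g a ha]) hdet
  · obtain ⟨f, hf⟩ := hback f'
    exact ⟨f, unique (hF f) hf⟩
  · refine unique (hF (f.map φ)) fun a ha => ?_
    exact congrArg φ.toFun (hF f a ha)
  · exact hval f (F f) (hF f)

end ColoringsCorrespond

end Diagram

/-! ### Erasing crossings -/

namespace Diagram

open Setoid Biquandle

variable {D D' : Diagram} {X : Type*} [Biquandle X] {R : Type*} [CommRing R]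

namespace Erasure

variable {T : Set D.Crossing} (h : Erasure D D' T)
include h

theorem endArc_eq (c : D'.Crossing) (s : Strand) (b : Bool) :
    D'.endArc c s b = h.arc (D.endArc (h.crossing c) s b) := by
  have hs := h.sign_eq c
  cases s <;> cases b <;>
    simp only [endArc, underLeft, underRight, overLeft, overRight, hs, h.inn_eq, h.out_eq] <;>
    split <;> rfl

theorem ker_arc {T' : Finset D.Crossing} (hT : ∀ c, c ∈ T ↔ c ∈ T') :
    ker h.arc = ⨆ c ∈ T', through (D.endArc c) := by
  have through_iff : ∀ (S : Setoid D.Arc) (c : D.Crossing), through (D.endArc c) ≤ S ↔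
      ∀ s, S (D.inn c s) (D.out c s) := by
    intro S c
    have : (∀ s, S (D.inn c s) (D.out c s)) ↔
        S (D.inn c .lower) (D.out c .lower) ∧ S (D.inn c .upper) (D.out c .upper) :=
      ⟨fun h => ⟨h _, h _⟩, fun h s => by cases s; exacts [h.2, h.1]⟩
    rw [this, through, sup_le_iff, link_le_iff_rel, link_le_iff_rel]
    rcases D.sign_eq_one_or c with hc | hc <;>
      simp only [endArc, underLeft, underRight, overLeft, overRight, hc, neg_one_ne_one, if_true,
        if_false]
    · rw [S.comm' (x := D.out c .upper)]
    · rw [S.comm' (x := D.out c .lower)]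
  have hker : ker h.arc = Relation.EqvGen.setoid (D.Through T) :=
    Setoid.ext fun a b => h.arc_eq_iff a b
  rw [hker]
  apply le_antisymm
  · refine Setoid.eqvGen_le ?_
    rintro a b ⟨c, hc, s, rfl, rfl⟩
    exact (through_iff _ c).1 (le_iSup₂_of_le c ((hT c).1 hc) le_rfl) s
  · exact iSup₂_le fun c hc => (through_iff _ c).2 fun s => .rel _ _ ⟨c, (hT c).2 hc, s, rfl, rfl⟩

theorem writhe_eq {T' : Finset D.Crossing} (hT : ∀ c, c ∈ T ↔ c ∈ T') :
    D.writhe = ∑ c ∈ T', (D.sign c : ℤ) + D'.writhe := by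
  rw [writhe, ← Finset.sum_add_sum_compl T']
  congr 1
  let e : D'.Crossing ≃ {c // c ∉ T'} :=
    h.crossing.trans (Equiv.subtypeEquivRight fun c => not_congr (hT c))
  have he : D'.writhe = ∑ c, (D.sign (e c) : ℤ) := Finset.sum_congr rfl fun c _ => by
    rw [h.sign_eq]
    rfl
  rw [he, Equiv.sum_comp e fun c => (D.sign c : ℤ)]
  exact Finset.sum_subtype _ (by simp) _

theorem arc_endArc {c : D.Crossing} (hc : c ∈ T) (s : Strand) (b b' : Bool) :
    h.arc (D.endArc c s b) = h.arc (D.endArc c s b') := by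
  suffices h.arc (D.endArc c s true) = h.arc (D.endArc c s false) by
    cases b <;> cases b' <;> simp [this]
  have hle : through (D.endArc c) ≤ ker h.arc := by
    classical
    exact h.ker_arc (T' := T.toFinite.toFinset) (by simp) ▸ le_iSup₂_of_le c (by simpa) le_rfl
  rw [through, sup_le_iff, link_le_iff_rel, link_le_iff_rel] at hle
  cases s
  · exact hle.2
  · exact hle.1

/-- Erasing the crossings of `T` preserves the colorings and their bracket values, provided that
the labels off the semiarcs between these crossings extend in one way to `D` and in one way to
`D'`, and that the states of `T` sum up to the straightened strands, times the power of `w` by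
which the normalisations differ. -/
theorem coloringsCorrespond {β : BiquandleBracket X R} {T' : Finset D.Crossing}
    (hT : ∀ c, c ∈ T ↔ c ∈ T') (Ext : Set D.Arc)
    (hout : ∀ c ∉ T', ∀ s b, D.endArc c s b ∈ Ext)
    (hsurj : ∀ a, ∃ a' ∈ Ext, h.arc a' = h.arc a)
    (hto : ∀ f : D.Coloring X, ∃ g : D.Arc → X, (∀ a ∈ Ext, g a = f.color a) ∧
      ∀ c ∈ T', ∀ s, g (D.endArc c s true) = g (D.endArc c s false))
    (hback : ∀ g : D.Arc → X, (∀ c ∈ T', ∀ s, g (D.endArc c s true) = g (D.endArc c s false)) →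
      ∃ col : D.Arc → X, (∀ a ∈ Ext, col a = g a) ∧
        ∀ c ∈ T', ∃ q, ∀ s b, col (D.endArc c s b) = endLabel q s b)
    (hdet : ∀ a ∉ Ext, ∃ c s₀ b₀ b b', a = D.endArc c s₀ b₀ ∧ D.endArc c .lower b ∈ Ext ∧
      D.endArc c .upper b' ∈ Ext)
    (hsum : ∀ f : D.Coloring X, stateSum D.endArc (f.coeffs β) β.δ =
      ((β.w ^ (∑ c ∈ T', (D.sign c : ℤ)) : Rˣ) : R) * outerSum D.endArc (f.coeffs β) T'
        fun E => β.δ ^ (E ⊔ ⨆ c ∈ T', through (D.endArc c)).classCount) :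
    ColoringsCorrespond β D D' := by
  have hker := h.ker_arc hT
  have crossing_notMem : ∀ c, (h.crossing c : D.Crossing) ∉ T' := fun c hc =>
    (h.crossing c).2 ((hT _).2 hc)
  refine ColoringsCorrespond.of_agree h.arc Ext (fun a' ha' => (ha' ?_).elim) (fun f => ?_)
    (fun f' => ?_) hdet fun f f' hff' => ?_
  · obtain ⟨a, rfl⟩ := h.arc_surjective a'
    obtain ⟨a', ha', h'⟩ := hsurj a
    exact ⟨a', ha', h'⟩
  · obtain ⟨g, hg, hgT⟩ := hto f
    have hle : ker h.arc ≤ ker g := by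
      rw [hker]
      refine iSup₂_le fun c hc => ?_
      rw [through, sup_le_iff, link_le_iff_rel, link_le_iff_rel]
      exact ⟨hgT c hc _, hgT c hc _⟩
    have hlift : ∀ a, g (Function.surjInv h.arc_surjective (h.arc a)) = g a := fun a =>
      hle (Function.surjInv_eq h.arc_surjective (h.arc a))
    refine ⟨Coloring.ofEndLabels (fun a' => g (Function.surjInv h.arc_surjective a')) fun c =>
      ⟨f.leftLabels (h.crossing c), fun s b => ?_⟩, fun a ha => ?_⟩
    · rw [h.endArc_eq, hlift, hg _ (hout _ (crossing_notMem c) _ _), f.color_endArc]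
    · exact (hlift a).trans (hg a ha)
  · obtain ⟨col, hcol, hcolT⟩ := hback (fun a => f'.color (h.arc a)) fun c hc s => by
      rw [h.arc_endArc ((hT c).2 hc) s true false]
    refine ⟨Coloring.ofEndLabels col fun c => ?_, fun a ha => (hcol a ha).symm⟩
    by_cases hc : c ∈ T'
    · exact hcolT c hc
    · refine ⟨f'.leftLabels (h.crossing.symm ⟨c, fun h' => hc ((hT c).1 h')⟩), fun s b => ?_⟩
      rw [hcol _ (hout c hc s b), ← f'.color_endArc, h.endArc_eq, Equiv.apply_symm_apply]
  · rw [Coloring.bracketValue_eq, Coloring.bracketValue_eq, hsum,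
      outerSum_through_eq_stateSum
        (h.crossing.trans (Equiv.subtypeEquivRight fun c => not_congr (hT c))) h.arc
        h.arc_surjective hker h.endArc_eq (f' := f'.coeffs β), ← mul_assoc, ← Units.val_mul, ← zpow_add,
        h.writhe_eq hT]
    · congr 4
      ring
    · intro c
      have hl : f'.leftLabels c = f.leftLabels (h.crossing c) := by
        refine f'.leftLabels_eq (b := true) (b' := true) ?_ ?_ <;>
        rw [h.endArc_eq, hff' _ (hout _ (crossing_notMem c) _ _), f.color_endArc]
      ext x
      simp only [Coloring.coeffs, hl, h.sign_eq]
      rfl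

end Erasure

/-! ### Invariance under the moves -/

variable (β : BiquandleBracket X R)

theorem coloringsCorrespond_of_isotopy (h : Erasure D D' ∅) : ColoringsCorrespond β D D' := by
  refine h.coloringsCorrespond (T' := ∅) (by simp) Set.univ (by simp) (fun a => ⟨a, by simp⟩)
    (fun f => ⟨f.color, by simp⟩) (fun g _ => ⟨g, by simp⟩) (by simp) fun f => ?_
  rw [stateSum_eq_outerSum]
  simp

theorem coloringsCorrespond_of_kink [Finite X] {c : D.Crossing} {s : Strand}
    (kink : D.out c s = D.inn c s.other) (h : Erasure D D' {c}) : ColoringsCorrespond β D D' := by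
  classical
  obtain ⟨b, hb⟩ : ∃ b, D.endArc c .lower b = D.endArc c .upper b := by
    rcases D.sign_eq_one_or c with hc | hc <;> cases s
    · exact ⟨true, by simpa [endArc, underLeft, overLeft, hc, Strand.other] using kink.symm⟩
    · exact ⟨false, by simpa [endArc, underRight, overRight, hc, Strand.other] using kink⟩
    · exact ⟨false, by
        simpa [endArc, underRight, overRight, hc, Strand.other, neg_one_ne_one] using kink.symm⟩
    · exact ⟨true, by
        simpa [endArc, underLeft, overLeft, hc, Strand.other, neg_one_ne_one] using kink⟩
  set k := D.endArc c .lower b with hk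
  have ne := @AtMostTwoEnds.ne _ _ _ D.atMostTwoEnds_endArc c .lower b c .upper b _ rfl hb.symm
    (by simp)
  have nel : D.endArc c .lower (!b) ≠ k := ne (by simp) (by simp)
  have neu : D.endArc c .upper (!b) ≠ k := ne (by simp) (by simp)
  have hq : ∀ f : D.Coloring X, (f.leftLabels c).1 = (f.leftLabels c).2 := fun f =>
    endLabel_eq_of_kink (b := b) (by rw [← f.color_endArc, ← f.color_endArc, ← hb])
  have mem : ∀ d, d ∈ ({c} : Set D.Crossing) ↔ d ∈ ({c} : Finset D.Crossing) := by simp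
  -- only the semiarc of the kink changes its label
  refine h.coloringsCorrespond mem {k}ᶜ ?_ (fun a => ?_) (fun f => ?_) (fun g hg => ?_)
    (fun a ha => ?_) fun f => ?_
  · intro c' hc' s' b'
    have : c ≠ c' := by simpa [eq_comm] using hc'
    exact ne (by simp [this]) (by simp [this])
  · by_cases ha : a = k
    · refine ⟨D.endArc c .lower !b, nel, ?_⟩
      rw [ha]
      exact h.arc_endArc (Set.mem_singleton c) _ _ _
    · exact ⟨a, ha, rfl⟩
  · refine ⟨Function.update f.color k (f.color (D.endArc c .lower !b)), fun a ha =>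
      Function.update_of_ne ha _ _, fun c' hc' s' => ?_⟩
    obtain rfl : c' = c := by simpa using hc'
    refine Bool.apply_true_eq_apply_false (g := fun x => Function.update f.color k
      (f.color (D.endArc c' .lower !b)) (D.endArc c' s' x)) (b := b) ?_
    cases s'
    · simp only [← hb, Function.update_self, Function.update_of_ne neu, f.color_endArc]
      exact (endLabel_diag (hq f) _ _ _)
    · simp only [← hk, Function.update_self, Function.update_of_ne nel]
  · have hg' : ∀ s b', g (D.endArc c s b') = g k := by
      have h1 : ∀ s b' b'', g (D.endArc c s b') = g (D.endArc c s b'') := by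
        intro s b' b''
        have := hg c (by simp) s
        cases b' <;> cases b'' <;> simp [this]
      intro s b'
      cases s
      · rw [h1 _ b' b, ← hb]
      · rw [h1 _ b' b]
    obtain ⟨x, hx⟩ : ∃ x, endLabel (x, x) .lower (!b) = g k := by
      cases b
      · exact ⟨g k, rfl⟩
      · exact surjective_underBy_self (g k)
    refine ⟨Function.update g k (endLabel (x, x) .lower b), fun a ha =>
      Function.update_of_ne ha _ _, fun c' hc' => ⟨(x, x), fun s' b' => ?_⟩⟩
    obtain rfl : c' = c := by simpa using hc'
    by_cases hbb : b' = b
    · subst hbb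
      have : D.endArc c' s' b' = k := by
        cases s'
        · exact hb.symm
        · rfl
      rw [this, Function.update_self]
      exact endLabel_diag rfl _ _ _
    · obtain rfl : b' = !b := by simpa using Bool.eq_not_of_ne hbb
      have : D.endArc c' s' (!b) ≠ k := by cases s' <;> assumption
      rw [Function.update_of_ne this, hg', ← hx]
      exact endLabel_diag rfl _ _ _
  · have ha : a = k := by simpa using ha
    exact ⟨c, .lower, b, !b, !b, ha, nel, neu⟩
  · rw [stateSum_eq_of_kink D.atMostTwoEnds_endArc _ _ hb, Finset.sum_singleton]
    congr 1
    have : f.leftLabels c = ((f.leftLabels c).1, (f.leftLabels c).1) := Prod.ext rfl (hq f).symm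
    rw [← β.coeff_kink (D.sign c) (f.leftLabels c).1, ← this]
    rfl

theorem coloringsCorrespond_of_bigon {c d : D.Crossing} (sign : D.sign c = -D.sign d)
    (hover : D.out c .upper = D.inn d .upper)
    (hunder : D.out c .lower = D.inn d .lower ∨ D.out d .lower = D.inn c .lower)
    (h : Erasure D D' {c, d}) : ColoringsCorrespond β D D' := by
  classical
  have hcd : c ≠ d := by
    rintro rfl
    rcases D.sign_eq_one_or c with hc | hc <;> simp [hc] at sign
  obtain ⟨b', hu⟩ : ∃ b, D.endArc c .upper b = D.endArc d .upper b := by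
    rcases D.sign_eq_one_or d with hd | hd <;> rw [hd] at sign
    · exact ⟨false, by simpa [endArc, overRight, sign, hd, neg_one_ne_one] using hover⟩
    · exact ⟨true, by simpa [endArc, overLeft, sign, hd, neg_one_ne_one] using hover⟩
  obtain ⟨b, hl⟩ : ∃ b, D.endArc c .lower b = D.endArc d .lower b := by
    rcases D.sign_eq_one_or d with hd | hd <;> rw [hd] at sign <;> rcases hunder with hun | hun
    · exact ⟨true, by simpa [endArc, underLeft, sign, hd, neg_one_ne_one] using hun⟩
    · exact ⟨false, by simpa [endArc, underRight, sign, hd, neg_one_ne_one] using hun.symm⟩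
    · exact ⟨false, by simpa [endArc, underRight, sign, hd, neg_one_ne_one] using hun⟩
    · exact ⟨true, by simpa [endArc, underLeft, sign, hd, neg_one_ne_one] using hun.symm⟩
  set i := D.endArc c .lower b with hi
  set j := D.endArc c .upper b' with hj
  have ne_i := @AtMostTwoEnds.ne _ _ _ D.atMostTwoEnds_endArc c .lower b d .lower b i rfl hl.symm
    (by simp [hcd])
  have ne_j := @AtMostTwoEnds.ne _ _ _ D.atMostTwoEnds_endArc c .upper b' d .upper b' j rfl hu.symm
    (by simp [hcd])
  have hij : i ≠ j := hi ▸ ne_j (by simp) (by simp)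
  have mem : ∀ x, x ∈ ({c, d} : Set D.Crossing) ↔ x ∈ ({c, d} : Finset D.Crossing) := by simp
  have inner : ∀ x ∈ ({c, d} : Finset D.Crossing),
      D.endArc x .lower b = i ∧ D.endArc x .upper b' = j := by
    intro x hx
    obtain rfl | rfl : x = c ∨ x = d := by simpa using hx
    · exact ⟨rfl, rfl⟩
    · exact ⟨hl.symm, hu.symm⟩
  have outer_lower : ∀ x ∈ ({c, d} : Finset D.Crossing),
      D.endArc x .lower (!b) ≠ i ∧ D.endArc x .lower (!b) ≠ j := fun x _ =>
    ⟨ne_i (by simp) (by simp), ne_j (by simp) (by simp)⟩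
  have outer_upper : ∀ x ∈ ({c, d} : Finset D.Crossing),
      D.endArc x .upper (!b') ≠ i ∧ D.endArc x .upper (!b') ≠ j := fun x _ =>
    ⟨ne_i (by simp) (by simp), ne_j (by simp) (by simp)⟩
  have hc : c ∈ ({c, d} : Finset D.Crossing) := by simp
  have hq : ∀ f : D.Coloring X, ∀ x ∈ ({c, d} : Finset D.Crossing),
      f.leftLabels x = f.leftLabels c := fun f x hx =>
    f.leftLabels_eq (b := b) (b' := b') (by rw [(inner x hx).1, hi, f.color_endArc])
      (by rw [(inner x hx).2, hj, f.color_endArc])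
  -- only the two sides of the bigon change their labels
  refine h.coloringsCorrespond mem {i, j}ᶜ ?_ (fun a => ?_) (fun f => ?_) (fun g hg => ?_)
    (fun a ha => ?_) fun f => ?_
  · intro x hx s y
    have hx : c ≠ x ∧ d ≠ x := by simpa [eq_comm] using hx
    simp [ne_i (c'' := x) (s'' := s) (b'' := y) (by simp [hx]) (by simp [hx]),
      ne_j (c'' := x) (s'' := s) (b'' := y) (by simp [hx]) (by simp [hx])]
  · by_cases ha : a = i
    · refine ⟨D.endArc c .lower !b, by simp [outer_lower c hc], ?_⟩
      rw [ha]
      exact h.arc_endArc (by simp) _ _ _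
    · by_cases ha' : a = j
      · refine ⟨D.endArc c .upper !b', by simp [outer_upper c hc], ?_⟩
        rw [ha']
        exact h.arc_endArc (by simp) _ _ _
      · exact ⟨a, by simp [ha, ha'], rfl⟩
  · let g := Function.update (Function.update f.color i (f.color (D.endArc c .lower !b))) j
      (f.color (D.endArc c .upper !b'))
    have gi : g i = f.color (D.endArc c .lower !b) := by simp [g, hij]
    have gj : g j = f.color (D.endArc c .upper !b') := by simp [g]
    have gext : ∀ a, a ≠ i ∧ a ≠ j → g a = f.color a := fun a ha => by simp [g, ha]
    refine ⟨g, fun a ha => gext a (by simpa using ha), fun x hx s => ?_⟩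
    cases s
    · refine Bool.apply_true_eq_apply_false (g := fun y => g (D.endArc x .upper y)) (b := b') ?_
      simp only [(inner x hx).2, gj, gext _ (outer_upper x hx), f.color_endArc, hq f x hx]
    · refine Bool.apply_true_eq_apply_false (g := fun y => g (D.endArc x .lower y)) (b := b) ?_
      simp only [(inner x hx).1, gi, gext _ (outer_lower x hx), f.color_endArc, hq f x hx]
  · have hg' : ∀ x ∈ ({c, d} : Finset D.Crossing), ∀ s y y',
        g (D.endArc x s y) = g (D.endArc x s y') := by
      intro x hx s y y'
      have := hg x hx s
      cases y <;> cases y' <;> simp [this]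
    obtain ⟨q, hqc⟩ := (bijective_endLabel (!b) (!b')).2
      (g (D.endArc c .lower !b), g (D.endArc c .upper !b'))
    obtain ⟨hqi, hqj⟩ := Prod.mk.inj hqc
    let col := Function.update (Function.update g i (endLabel q .lower b)) j (endLabel q .upper b')
    have ci : col i = endLabel q .lower b := by simp [col, hij]
    have cj : col j = endLabel q .upper b' := by simp [col]
    have cext : ∀ a, a ≠ i ∧ a ≠ j → col a = g a := fun a ha => by simp [col, ha]
    refine ⟨col, fun a ha => cext a (by simpa using ha), fun x hx => ⟨q, fun s y => ?_⟩⟩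
    cases s
    · revert y
      refine Bool.forall_of_not (b := b') ?_ ?_
      · rw [(inner x hx).2, cj]
      · rw [cext _ (outer_upper x hx), hqj, hg' x hx _ _ b', hg' c hc _ _ b', (inner x hx).2]
    · revert y
      refine Bool.forall_of_not (b := b) ?_ ?_
      · rw [(inner x hx).1, ci]
      · rw [cext _ (outer_lower x hx), hqi, hg' x hx _ _ b, hg' c hc _ _ b, (inner x hx).1]
  · have ha : a = i ∨ a = j := by
      rw [Set.mem_compl_iff, not_not] at ha
      simpa using ha
    rcases ha with ha | ha
    · exact ⟨c, .lower, b, !b, !b', ha, by simp [outer_lower c hc], by simp [outer_upper c hc]⟩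
    · exact ⟨c, .upper, b', !b, !b', ha, by simp [outer_lower c hc], by simp [outer_upper c hc]⟩
  · have hqd := hq f d (by simp)
    have hsign : D.sign d = -D.sign c := by rw [sign, neg_neg]
    have hw : ∑ x ∈ ({c, d} : Finset D.Crossing), (D.sign x : ℤ) = 0 := by
      rw [Finset.sum_pair hcd, hsign]
      simp
    rw [hw, zpow_zero, Units.val_one, one_mul]
    refine stateSum_eq_of_bigon D.atMostTwoEnds_endArc hcd hl hu (fun x => ?_) ?_
    · rw [Coloring.coeffs, Coloring.coeffs, hqd, hsign, ← Units.val_mul, β.coeff_mul_coeff_neg,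
        Units.val_one]
    · simp only [Coloring.coeffs, hqd, hsign]
      exact β.coeff_cross _ _

end Diagram

/-! ### Moving a strand across a crossing -/

section Triangle

open Biquandle

variable {C α X : Type*} [Biquandle X] {e e' : C → Strand → Bool → α} {u v t : C}
  {pu pv pt : Bool} {i j k : α}

/-- The labels `col` of the ends `e` at `u`, `v`, `t` are three of the six pairs of left labels that
belong to `x`, `y`, `z`. -/
structure TriangleLabels (e : C → Strand → Bool → α) (u v t : C) (pu pv pt : Bool) (col : α → X)
    (x y z : X) : Prop where
  label_u : ∀ s b, col (e u s b) = endLabel (pairU pu x y z) s b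
  label_v : ∀ s b, col (e v s b) = endLabel (pairV pv x y z) s b
  label_t : ∀ s b, col (e t s b) = endLabel (pairT pt x y z) s b

theorem TriangleSides.exists_labels (h : TriangleSides e u v t pu pv pt i j k) {col : α → X}
    (hcol : ∀ c, ∃ q, ∀ s b, col (e c s b) = endLabel q s b) :
    ∃ x y z, TriangleLabels e u v t pu pv pt col x y z := by
  obtain ⟨qu, hu⟩ := hcol u
  obtain ⟨qv, hv⟩ := hcol v
  obtain ⟨qt, ht⟩ := hcol t
  obtain ⟨x, y, z, rfl, rfl, rfl⟩ := exists_pairs_of_sides (pu := pu) (pv := pv) (pt := pt)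
    (qu := qu) (qv := qv) (qt := qt)
    (by rw [← hu, ← ht, h.bottom_u, h.bottom_t]) (by rw [← hu, ← hv, h.middle_u, h.middle_v])
    (by rw [← hv, ← ht, h.top_v, h.top_t])
  exact ⟨x, y, z, hu, hv, ht⟩

/-- The outer ends of the moved triangle carry labels of the three other pairs. -/
theorem TriangleLabels.outer {col : α → X} {x y z : X}
    (h : TriangleLabels e u v t pu pv pt col x y z) (hs : TriangleSwap e e' u v t pu pv pt) :
    (col (e' u .lower !pt) = endLabel (pairU (!pu) x y z) .lower (!pt) ∧
      col (e' u .upper pv) = endLabel (pairU (!pu) x y z) .upper pv) ∧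
    (col (e' v .lower pu) = endLabel (pairV (!pv) x y z) .lower pu ∧
      col (e' v .upper !pt) = endLabel (pairV (!pv) x y z) .upper (!pt)) ∧
    col (e' t .lower pu) = endLabel (pairT (!pt) x y z) .lower pu ∧
      col (e' t .upper pv) = endLabel (pairT (!pt) x y z) .upper pv := by
  refine ⟨⟨?_, ?_⟩, ⟨?_, ?_⟩, ?_, ?_⟩
  · rw [hs.bottom_u, h.label_t, endLabel_bottom]
  · rw [hs.middle_u, h.label_v, endLabel_middle]
  · rw [hs.middle_v, h.label_u, endLabel_middle]
  · rw [hs.top_v, h.label_t, endLabel_top]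
  · rw [hs.bottom_t, h.label_u, ← endLabel_bottom, Bool.not_not]
  · rw [hs.top_t, h.label_v, ← endLabel_top, Bool.not_not]

/-- A coloring extends across a triangle move, after relabelling the three sides. -/
theorem exists_coloring_of_triangle (he : AtMostTwoEnds e) (huv : u ≠ v) (hvt : v ≠ t)
    (hut : u ≠ t) (h : TriangleSides e u v t pu pv pt i j k)
    (h' : TriangleSides e' u v t (!pu) (!pv) (!pt) i j k) (hs : TriangleSwap e e' u v t pu pv pt)
    {col : α → X} (hcol : ∀ c, ∃ q, ∀ s b, col (e c s b) = endLabel q s b) :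
    ∃ col' : α → X, (∀ a, a ≠ i ∧ a ≠ j ∧ a ≠ k → col' a = col a) ∧
      ∀ c, ∃ q, ∀ s b, col' (e' c s b) = endLabel q s b := by
  classical
  obtain ⟨x, y, z, hxyz⟩ := h.exists_labels hcol
  obtain ⟨hij, hik, hjk⟩ := h.sides_ne he huv hvt hut
  obtain ⟨hout, haway⟩ := h.outer_ne he huv hvt hut
  simp only [Set.mem_insert_iff, Set.mem_singleton_iff, forall_eq_or_imp, forall_eq] at hout
  obtain ⟨hbu, hmu, hmv, htv, hbt, htt⟩ := hout
  obtain ⟨⟨u1, u2⟩, ⟨v1, v2⟩, t1, t2⟩ := hxyz.outer hs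
  let col' : α → X := Function.update (Function.update (Function.update col
    i (endLabel (pairU (!pu) x y z) .lower pt)) j (endLabel (pairU (!pu) x y z) .upper !pv))
    k (endLabel (pairV (!pv) x y z) .upper pt)
  have ci : col' i = endLabel (pairU (!pu) x y z) .lower pt := by simp [col', hij, hik]
  have cj : col' j = endLabel (pairU (!pu) x y z) .upper !pv := by simp [col', hjk]
  have ck : col' k = endLabel (pairV (!pv) x y z) .upper pt := by simp [col']
  have cext : ∀ a, a ≠ i ∧ a ≠ j ∧ a ≠ k → col' a = col a := fun a ha => by simp [col', ha]
  have hb := endLabel_bottom (!pu) (!pt) x y z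
  have hm := endLabel_middle (!pu) (!pv) x y z
  have ht := endLabel_top (!pv) (!pt) x y z
  rw [Bool.not_not] at hb ht
  refine ⟨col', cext, fun c => ?_⟩
  by_cases hcu : c = u
  · subst hcu
    refine ⟨pairU (!pu) x y z, fun s b => ?_⟩
    cases s <;> revert b
    · refine Bool.forall_of_not (b := pv) ?_ ?_
      · rw [← u2, cext _ (by rwa [hs.middle_u])]
      · rw [h'.middle_u, cj]
    · refine Bool.forall_of_not (b := pt) ?_ ?_
      · rw [← ci, ← h'.bottom_u, Bool.not_not]
      · rw [← u1, cext _ (by rwa [hs.bottom_u])]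
  by_cases hcv : c = v
  · subst hcv
    refine ⟨pairV (!pv) x y z, fun s b => ?_⟩
    cases s <;> revert b
    · refine Bool.forall_of_not (b := pt) ?_ ?_
      · rw [← ck, ← h'.top_v, Bool.not_not]
      · rw [← v2, cext _ (by rwa [hs.top_v])]
    · refine Bool.forall_of_not (b := pu) ?_ ?_
      · rw [← v1, cext _ (by rwa [hs.middle_v])]
      · rw [h'.middle_v, cj, hm]
  by_cases hct : c = t
  · subst hct
    refine ⟨pairT (!pt) x y z, fun s b => ?_⟩
    cases s <;> revert b
    · refine Bool.forall_of_not (b := pv) ?_ ?_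
      · rw [← t2, cext _ (by rwa [hs.top_t])]
      · rw [h'.top_t, ck, ht]
    · refine Bool.forall_of_not (b := pu) ?_ ?_
      · rw [← t1, cext _ (by rwa [hs.bottom_t])]
      · rw [h'.bottom_t, ci, hb]
  obtain ⟨q, hq⟩ := hcol c
  refine ⟨q, fun s b => ?_⟩
  rw [hs.away c hcu hcv hct, cext _ (haway c hcu hcv hct s b), hq]

end Triangle

namespace Diagram

open Setoid Biquandle BiquandleBracket

variable {D D' : Diagram} {X : Type*} [Biquandle X] {R : Type*} [CommRing R]

/-- The ends of the crossings of `D'`, in terms of the crossings and semiarcs of `D`. -/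
def TriangleMove.endArc {u v t : D.Crossing} (h : TriangleMove D D' u v t) (c : D.Crossing)
    (s : Strand) (b : Bool) : D.Arc :=
  h.arc.symm (D'.endArc (h.crossing c) s b)

/-- The triangle and its image, in terms of ends. Whether a side of the triangle is a left or a
right end at one of its two crossings depends on the sign of the other one. The parameter `ε` is
`1` if `D` is that side of the move to which positive crossings contribute the pairs with parameter
`true`, and `-1` otherwise. -/
theorem TriangleMove.exists_sides {u v t : D.Crossing} {ob om ot : ℤˣ}
    (triangle : D.IsTriangle u v t ob om ot) (h : TriangleMove D D' u v t) :
    ∃ (ε : ℤˣ) (pu pv pt : Bool) (i j k : D.Arc),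
      (D.sign u = signOf ε pu ∧ D.sign v = signOf ε pv ∧ D.sign t = signOf ε pt) ∧
      TriangleSides D.endArc u v t pu pv pt i j k ∧
      TriangleSides h.endArc u v t (!pu) (!pv) (!pt) i j k ∧
      TriangleSwap D.endArc h.endArc u v t pu pv pt := by
  obtain ⟨huv, hvt, hut, hb, hm, ht, hbm, hmt⟩ := triangle
  have sign_of : ∀ ε s : ℤˣ, s = signOf ε (decide (s = ε)) := by decide
  let ε := ob * D.sign u * D.sign t
  let p := fun c => decide (D.sign c = ε)
  refine ⟨ε, p u, p v, p t, D.endArc u .lower !p t, D.endArc u .upper (p v),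
    D.endArc v .upper !p t, ⟨sign_of _ _, sign_of _ _, sign_of _ _⟩, ?_⟩
  simp only [p, ε]
  have hinn : ∀ c s, h.arc.symm (D'.inn (h.crossing c) s) =
      D.inn (D.triangleSwap u v t (c, s)).1 (D.triangleSwap u v t (c, s)).2 := fun c s => by
    rw [h.inn_eq, Equiv.symm_apply_apply]
  have hout : ∀ c s, h.arc.symm (D'.out (h.crossing c) s) =
      D.out (D.triangleSwap u v t (c, s)).1 (D.triangleSwap u v t (c, s)).2 := fun c s => by
    rw [h.out_eq, Equiv.symm_apply_apply]
  have ul : D.triangleSwap u v t (u, .lower) = (t, .lower) := by simp [triangleSwap]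
  have uu : D.triangleSwap u v t (u, .upper) = (v, .lower) := by simp [triangleSwap]
  have vl : D.triangleSwap u v t (v, .lower) = (u, .upper) := by
    simp [triangleSwap, huv.symm, hvt]
  have vu : D.triangleSwap u v t (v, .upper) = (t, .upper) := by simp [triangleSwap, huv.symm]
  have tl : D.triangleSwap u v t (t, .lower) = (u, .lower) := by simp [triangleSwap, hut.symm]
  have tu : D.triangleSwap u v t (t, .upper) = (v, .upper) := by
    simp [triangleSwap, hut.symm, hvt.symm]
  have he : ∀ c s b, h.endArc c s b = if D.isInn c s b then h.arc.symm (D'.inn (h.crossing c) s)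
      else h.arc.symm (D'.out (h.crossing c) s) := by
    intro c s b
    rw [TriangleMove.endArc, Diagram.endArc_eq]
    have : D'.isInn (h.crossing c) s b = D.isInn c s b := by cases s <;> simp [isInn, h.sign_eq]
    rw [this]
    split <;> rfl
  have away : ∀ c, c ≠ u → c ≠ v → c ≠ t → h.endArc c = D.endArc c := by
    intro c hu hv ht
    ext s b
    have : D.triangleSwap u v t (c, s) = (c, s) := by cases s <;> simp [triangleSwap, hu, hv, ht]
    rw [he, hinn, hout, this, Diagram.endArc_eq]
  simp only [Follows] at hb hm ht
  -- the two equations between signs and directions leave sixteen of the cases below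
  rcases D.sign_eq_one_or u with su | su <;> rcases D.sign_eq_one_or v with sv | sv <;>
    rcases D.sign_eq_one_or t with st | st <;> rcases Int.units_eq_one_or ob with rfl | rfl <;>
    rcases Int.units_eq_one_or om with rfl | rfl <;>
    rcases Int.units_eq_one_or ot with rfl | rfl <;>
    simp [su, sv, st, neg_one_ne_one.symm] at hbm hmt hb hm ht <;>
    refine ⟨⟨?_, ?_, ?_, ?_, ?_, ?_⟩, ⟨?_, ?_, ?_, ?_, ?_, ?_⟩, ⟨?_, ?_, ?_, ?_, ?_, ?_, away⟩⟩ <;>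
    simp [su, sv, st, neg_one_ne_one.symm, he, Diagram.endArc_eq, isInn, hinn, hout,
      ul, uu, vl, vu, tl, tu, hb, hm, ht]

theorem TriangleMove.stateSum_eq {u v t : D.Crossing} (h : TriangleMove D D' u v t)
    (f : D'.Crossing → Smoothing → R) (δ : R) :
    stateSum D'.endArc f δ = stateSum h.endArc (fun c => f (h.crossing c)) δ := by
  have key := outerSum_through_eq_stateSum (e := D'.endArc) (f := f) (T := ∅)
    (e' := h.endArc) (f' := fun c => f (h.crossing c))
    (h.crossing.trans (Equiv.subtypeUnivEquiv (by simp)).symm) h.arc.symm h.arc.symm.surjective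
    (by simpa using (Setoid.ker_eq_bot_iff).2 h.arc.symm.injective) (fun _ _ _ => rfl)
    (fun _ => rfl) δ
  rw [← key, stateSum_eq_outerSum]
  simp

theorem TriangleMove.atMostTwoEnds {u v t : D.Crossing} (h : TriangleMove D D' u v t) :
    AtMostTwoEnds h.endArc := by
  intro c s b c' s' b' c'' s'' b'' h1 h2
  simpa only [h.crossing.apply_eq_iff_eq] using
    D'.atMostTwoEnds_endArc _ s b _ s' b' _ s'' b'' (h.arc.symm.injective h1)
      (h.arc.symm.injective h2)

theorem coloringsCorrespond_of_triangle (β : BiquandleBracket X R) {u v t : D.Crossing}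
    {ob om ot : ℤˣ} (triangle : D.IsTriangle u v t ob om ot) (h : TriangleMove D D' u v t) :
    ColoringsCorrespond β D D' := by
  obtain ⟨ε, pu, pv, pt, i, j, k, ⟨su, sv, st⟩, hD, hD', hs⟩ := h.exists_sides triangle
  obtain ⟨huv, hvt, hut⟩ := And.intro triangle.u_ne_v (And.intro triangle.v_ne_t triangle.u_ne_t)
  have he := D.atMostTwoEnds_endArc
  obtain ⟨hout, haway⟩ := hD.outer_ne he huv hvt hut
  simp only [Set.mem_insert_iff, Set.mem_singleton_iff, forall_eq_or_imp, forall_eq] at hout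
  obtain ⟨hbu, hmu, hmv, htv, hbt, htt⟩ := hout
  have harc : ∀ c s b, D'.endArc (h.crossing c) s b = h.arc (h.endArc c s b) := fun c s b =>
    (h.arc.apply_symm_apply _).symm
  have colD : ∀ f : D.Coloring X, ∀ c, ∃ q, ∀ s b, f.color (D.endArc c s b) = endLabel q s b :=
    fun f c => ⟨_, f.color_endArc c⟩
  -- only the three sides of the triangle change their labels
  refine ColoringsCorrespond.of_agree h.arc {a | a ≠ i ∧ a ≠ j ∧ a ≠ k} (fun a' ha' => ?_)
    (fun f => ?_) (fun f' => ?_) (fun a ha => ?_) fun f f' hff' => ?_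
  · obtain ⟨a, rfl⟩ := h.arc.surjective a'
    have ha : a = i ∨ a = j ∨ a = k := by
      by_contra hne
      push Not at hne
      exact ha' ⟨a, hne, rfl⟩
    have mem : ∀ c s b, h.endArc c s b ≠ i ∧ h.endArc c s b ≠ j ∧ h.endArc c s b ≠ k →
        D'.endArc (h.crossing c) s b ∈ h.arc '' {a | a ≠ i ∧ a ≠ j ∧ a ≠ k} := fun c s b hc =>
      ⟨_, hc, (harc c s b).symm⟩
    rcases ha with rfl | rfl | rfl
    · exact ⟨h.crossing u, .lower, _, _, _, by rw [harc, hD'.bottom_u],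
        mem _ _ _ (hs.bottom_u ▸ hbt), mem _ _ _ (hs.middle_u ▸ hmv)⟩
    · exact ⟨h.crossing u, .upper, _, _, _, by rw [harc, hD'.middle_u],
        mem _ _ _ (hs.bottom_u ▸ hbt), mem _ _ _ (hs.middle_u ▸ hmv)⟩
    · exact ⟨h.crossing v, .upper, _, _, _, by rw [harc, hD'.top_v],
        mem _ _ _ (hs.middle_v ▸ hmu), mem _ _ _ (hs.top_v ▸ htt)⟩
  · obtain ⟨col, hcol, hcol'⟩ := exists_coloring_of_triangle he huv hvt hut hD hD' hs (colD f)
    refine ⟨Coloring.ofEndLabels (fun a => col (h.arc.symm a)) fun c => ?_, fun a ha => ?_⟩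
    · obtain ⟨c, rfl⟩ := h.crossing.surjective c
      exact hcol' c
    · change col (h.arc.symm (h.arc a)) = _
      rw [h.arc.symm_apply_apply, hcol a ha]
  · obtain ⟨col, hcol, hcol'⟩ := exists_coloring_of_triangle (pu := !pu) (pv := !pv) (pt := !pt)
      (i := i) (j := j) (k := k) h.atMostTwoEnds huv hvt hut hD' (by simpa using hD) hs.symm
      (col := fun a => f'.color (h.arc a))
      fun c => ⟨f'.leftLabels (h.crossing c), fun s b => by rw [← harc, f'.color_endArc]⟩
    exact ⟨Coloring.ofEndLabels col hcol', fun a ha => (hcol a ha).symm⟩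
  · have ha : a = i ∨ a = j ∨ a = k := by
      by_contra hne
      push Not at hne
      exact ha hne
    rcases ha with rfl | rfl | rfl
    · exact ⟨u, .lower, _, _, _, hD.bottom_u.symm, hbu, hmu⟩
    · exact ⟨u, .upper, _, _, _, hD.middle_u.symm, hbu, hmu⟩
    · exact ⟨v, .upper, _, _, _, hD.top_v.symm, hmv, htv⟩
  · have hwrithe : D'.writhe = D.writhe := by
      rw [writhe, writhe, ← Equiv.sum_comp h.crossing]
      simp only [h.sign_eq]
    rw [Coloring.bracketValue_eq, Coloring.bracketValue_eq, hwrithe, h.stateSum_eq]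
    congr 1
    obtain ⟨x, y, z, hxyz⟩ := hD.exists_labels (colD f)
    obtain ⟨⟨u1, u2⟩, ⟨v1, v2⟩, t1, t2⟩ := hxyz.outer hs
    have lu : f.leftLabels u = pairU pu x y z :=
      f.leftLabels_eq (hxyz.label_u .lower true) (hxyz.label_u .upper true)
    have lv : f.leftLabels v = pairV pv x y z :=
      f.leftLabels_eq (hxyz.label_v .lower true) (hxyz.label_v .upper true)
    have lt : f.leftLabels t = pairT pt x y z :=
      f.leftLabels_eq (hxyz.label_t .lower true) (hxyz.label_t .upper true)
    have color_eq : ∀ c s b, h.endArc c s b ≠ i ∧ h.endArc c s b ≠ j ∧ h.endArc c s b ≠ k →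
        f'.color (D'.endArc (h.crossing c) s b) = f.color (h.endArc c s b) := fun c s b hc => by
      rw [harc, hff' _ hc]
    have lu' : f'.leftLabels (h.crossing u) = pairU (!pu) x y z :=
      f'.leftLabels_eq ((color_eq _ _ _ (hs.bottom_u ▸ hbt)).trans u1)
        ((color_eq _ _ _ (hs.middle_u ▸ hmv)).trans u2)
    have lv' : f'.leftLabels (h.crossing v) = pairV (!pv) x y z :=
      f'.leftLabels_eq ((color_eq _ _ _ (hs.middle_v ▸ hmu)).trans v1)
        ((color_eq _ _ _ (hs.top_v ▸ htt)).trans v2)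
    have lt' : f'.leftLabels (h.crossing t) = pairT (!pt) x y z :=
      f'.leftLabels_eq ((color_eq _ _ _ (hs.bottom_t ▸ hbu)).trans t1)
        ((color_eq _ _ _ (hs.top_t ▸ htv)).trans t2)
    have laway : ∀ c, c ≠ u → c ≠ v → c ≠ t →
        f'.leftLabels (h.crossing c) = f.leftLabels c := by
      intro c h1 h2 h3
      have hc := haway c h1 h2 h3
      refine f'.leftLabels_eq (b := true) (b' := true) ?_ ?_ <;>
        rw [color_eq _ _ _ (by rw [hs.away c h1 h2 h3]; exact hc _ _), hs.away c h1 h2 h3,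
          f.color_endArc]
    symm
    refine stateSum_eq_of_triangle he huv hvt hut hD hD' hs ?_ (β.hexagon ε pu pv pt x y z) ?_ ?_ ?_
    · intro c h1 h2 h3
      ext s
      simp only [Coloring.coeffs, laway c h1 h2 h3, h.sign_eq]
    · simp only [Coloring.coeffs, h.sign_eq, su, lu, lu', cornerCoeffs, and_self]
    · simp only [Coloring.coeffs, h.sign_eq, sv, lv, lv', cornerCoeffs, and_self]
    · simp only [Coloring.coeffs, h.sign_eq, st, lt, lt', cornerCoeffs, and_self]

/-- Every Reidemeister move preserves the colorings and their bracket values. -/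
theorem ReidemeisterMove.coloringsCorrespond [Finite X] (β : BiquandleBracket X R)
    (h : ReidemeisterMove D D') : ColoringsCorrespond β D D' := by
  cases h with
  | isotopy h => exact coloringsCorrespond_of_isotopy β h
  | one c s kink h => exact coloringsCorrespond_of_kink β kink h
  | two c d sign hover hunder h => exact coloringsCorrespond_of_bigon β sign hover hunder h
  | three u v t ob om ot triangle h => exact coloringsCorrespond_of_triangle β triangle h

end Diagram

theorem mainTheorem1 {X : Type*} [Biquandle X] [Finite X] {R : Type*} [CommRing R]
    (β : BiquandleBracket X R) (S : Set (BiquandleHom X X))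
    (L L' : LinkDiagram) (h : L.SameLink L') :
    Nonempty ((L.1.bracketQuiver β S).Iso (L'.1.bracketQuiver β S)) := by
  suffices Diagram.ColoringsCorrespond β L.1 L'.1 from this.nonempty_iso S
  induction h with
  | rel D D' h => exact h.coloringsCorrespond β
  | refl D => exact .refl D.1
  | symm D D' _ ih => exact ih.symm
  | trans D D' D'' _ _ ih ih' => exact ih.trans ih'
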